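/- All semigroups and categories below are nonempty and small. **Semigroups.** A *DRC-restriction semigroup* is $(S,\cdot,{}^+,{}^*)$, where $(S,\cdot)$ is a semigroup and for all $x,y\in S$: $x^+x=x$, $(xy)^+=(xy^+)^+$, $(xy)^+=x^+(xy)^+x^+$, $x^{++}=x^+$, $x^{+*}=x^+$, $xx^*=x$, $(xy)^*=(x^*y)^*$, $(xy)^*=y^*(xy)^*y^*$, $x^{**}=x^*$, $x^{*+}=x^*$, $x(yx)^*=(yx^+)^*x$ and $(xy)^+x=x(x^*y)^+$; put $P(S)=\{x^+\mid x\in S\}$. A *$P$-restriction semigroup* is $(S,\cdot,{}^+,{}^*)$ with $x^+x=x$, $(xy)^+=(xy^+)^+$, $(x^+y^+)^+=x^+y^+x^+$, $x^+x^+=x^+$, $x^{+*}=x^+$, $xx^*=x$, $(xy)^*=(x^*y)^*$, $(x^*y^*)^*=y^*x^*y^*$, $x^*x^*=x^*$, $x^{*+}=x^*$, $(xy)^+x=xy^+x^*$, $x(yx)^*=x^+y^*x$. A *restriction semigroup* is $(S,\cdot,{}^+,{}^*)$ with $x^+x=x$, $x^+y^+=y^+x^+=(x^+y^+)^+$, $x^+(xy)^+=(xy)^+=(xy^+)^+$,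 $x^{+*}=x^+$, $xx^*=x$, $x^*y^*=y^*x^*=(x^*y^*)^*$, $(xy)^*y^*=(xy)^*=(x^*y)^*$, $x^{*+}=x^*$, $(xy)^+x=xy^+$, $x(yx)^*=y^*x$. A *generalized regular $\circ$-semigroup* is $(S,\cdot,{}^\circ)$ with $xx^\circ x=x$, $x^{\circ\circ}=x$, $(xy)^\circ=(xy)^\circ xx^\circ=y^\circ y(xy)^\circ$, $(xy)^\circ x=(x^\circ xy)^\circ$; a *regular $\circ$-semigroup* is $(S,\cdot,{}^\circ)$ with $xx^\circ x=x$, $x^{\circ\circ}=x$, $(xy)^\circ=y^\circ x^\circ$; an *inverse semigroup* is a regular semigroup whose idempotents commute, and there $x^\circ$ denotes the unique inverse of $x$. In the last three cases put $x^+=xx^\circ$, $x^*=x^\circ x$. Each of these five classes thus consists of DRC-restriction semigroups with, possibly, additional structure. A *(2,1,1)-homomorphism* is a map preserving $\cdot$, ${}^+$ and ${}^*$. **Projection algebras.** A *strong projection algebra* is $(P,\times,\star)$ with $e\times e=e$, $(e\times f)\times e=e\times f$, $e\times(f\times g)=(e\times f)\times(f\times g)$, $(e\times f)\times g=(e\times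 f)\times(e\times g)$, the four left-right dual identities for $\star$, namely $e\star e=e$, $e\star(f\star e)=f\star e$, $(g\star f)\star e=(g\star f)\star(f\star e)$, $g\star(f\star e)=(g\star e)\star(f\star e)$, and $(e\star(f\times g))\star g=(e\star f)\star g$, $g\times((g\star f)\times e)=g\times(f\times e)$, $(e\times f)\star e=e\times f$, $f\times(e\star f)=e\star f$, $e\times(((e\times f)\times g)\star f)=(e\times f)\times g$, $(f\times(g\star(f\star e)))\star e=g\star(f\star e)$. Write $e\le_P f$ if $e=f\times e$, and $p\,\mathcal F\,q$ if $p\times q=p$ and $p\star q=q$. $P$ is *symmetric* if $e\times f=f\star e$, and *commutative* if $e\times f=f\times e$, for all $e,f$. A *path* is a sequence $(p_1,\dots,p_k)$, $k\ge1$, with $p_1\,\mathcal F\,p_2\,\mathcal F\cdots\mathcal F\,p_k$; paths $\mathfrak p,\mathfrak q$ with $p_k=q_1$ compose to $\mathfrak p\circ\mathfrak q=(p_1,\dots,p_k,q_2,\dots,q_l)$. Write $\mathfrak p\le\mathfrak q$ if there is $r\le_P q_1$ with $\mathfrak p=(r_1,\dots,r_k)$, where $r_1=r$ and $r_i=r_{i-1}\star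 q_i$. **Chain projection ordered categories.** View a small category as its set $C$ of arrows with the partial composition $\circ$ and the maps $\mathbf d,\mathbf r:C\to C$ giving the source and target identities, so that $a\circ b$ is defined iff $\mathbf r(a)=\mathbf d(b)$; let $P_C=\mathbf d(C)$. It is *ordered* by a partial order $\le$ on $C$ if $a\le b$ implies $\mathbf d(a)\le\mathbf d(b)$ and $\mathbf r(a)\le\mathbf r(b)$; $a\le b$, $c\le d$ imply $a\circ c\le b\circ d$ when both are defined; for $P_C\ni p\le\mathbf d(a)$ there is a unique ${}_p{\downharpoonleft}a\le a$ with source $p$; and for $P_C\ni q\le\mathbf r(a)$ there is a unique $a{\downharpoonright}_q\le a$ with target $q$. It is a *projection ordered category* if moreover $P_C$ is given the structure of a strong projection algebra, $\le$ restricts to $\le_{P_C}$ on $P_C$, and for all $a\in C$, $p,t\in P_C$ $$(p\Theta_a)\times t=(p\times t\Delta_a)\Theta_a,\qquad t\star(p\Delta_a)=(t\Theta_a\star p)\Delta_a,$$ where $x\Theta_a=\mathbf r({}_{x\star\mathbf d(a)}{\downharpoonleft}a)$ and $y\Delta_a=\mathbf d(a{\downharpoonright}_{\mathbf r(a)\times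 y})$. It is a *chain projection ordered category* if it is moreover given a map $\varepsilon$ from the paths in $P_C$ to $C$ with $\varepsilon(p)=\varepsilon(p,p)=p$; $\mathbf d(\varepsilon(\mathfrak p))=p_1$, $\mathbf r(\varepsilon(\mathfrak p))=p_k$; $\varepsilon(\mathfrak p\circ\mathfrak q)=\varepsilon(\mathfrak p)\circ\varepsilon(\mathfrak q)$; $\mathfrak p\le\mathfrak q\Rightarrow\varepsilon(\mathfrak p)\le\varepsilon(\mathfrak q)$; such that for all $b\in C$ and all $e,f\in P_C$ with $f=e\Theta_b\star f$ and $e=e\times f\Delta_b$, $$\varepsilon(e,e_1)\circ{}_{e_1}{\downharpoonleft}b\circ\varepsilon(f_1,f)=\varepsilon(e,e_2)\circ b{\downharpoonright}_{f_2}\circ\varepsilon(f_2,f),$$ where $e_1=e\star\mathbf d(b)$, $f_1=e\Theta_b$, $e_2=f\Delta_b$, $f_2=\mathbf r(b)\times f$. It is *symmetric* if $P_C$ is symmetric and $\varepsilon(p,q,p)=p$ whenever $p\,\mathcal F\,q$; *commutative* if $P_C$ is commutative; and a *chain projection ordered groupoid* if every arrow is invertible. A *chain projection ordered functor* is a map $\phi$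 between the arrow sets that preserves $\mathbf d$, $\mathbf r$, $\circ$, $\le$, the operations $\times,\star$ on objects, and $\varepsilon$ (i.e. $\varepsilon(p_1,\dots,p_k)\phi=\varepsilon(p_1\phi,\dots,p_k\phi)$). **Theorem.** There are mutually inverse functors $\mathbf C$ and $\mathbf S$ between the category of DRC-restriction semigroups with (2,1,1)-homomorphisms and the category of chain projection ordered categories with chain projection ordered functors. Both leave underlying sets and maps unchanged. $\mathbf C(S)$ has $\mathbf d(x)=x^+$, $\mathbf r(x)=x^*$, $x\circ y=xy$ if $x^*=y^+$, $x\le y$ iff $x=x^+y$ and $y^+x^+y^+=x^+$, $e\times f=(ef)^+$, $e\star f=(ef)^*$ and $\varepsilon(p_1,\dots,p_k)=p_1\cdots p_k$; $\mathbf S(C)$ has the product $a\bullet b=a{\downharpoonright}_{p}\circ\varepsilon(p,q)\circ{}_{q}{\downharpoonleft}b$ with $p=\mathbf r(a)\times\mathbf d(b)$, $q=\mathbf r(a)\star\mathbf d(b)$, and $a^+=\mathbf d(a)$, $a^*=\mathbf r(a)$. They restrict to isomorphisms between the following categories, with (2,1,1)-homomorphisms and with chain projection ordered functors as morphisms, respectively: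 1. generalized regular $\circ$-semigroups and chain projection ordered groupoids; 2. $P$-restriction semigroups and symmetric chain projection ordered categories; 3. regular $\circ$-semigroups and symmetric chain projection ordered groupoids; 4. restriction semigroups and commutative chain projection ordered categories; 5. inverse semigroups and commutative chain projection ordered groupoids. -/

import Mathlib

open CategoryTheory

universe u

namespace ChainPO

/-! ### Projection algebras -/

/-- Two-sided projection algebras. -/
class ProjectionAlgebra (P : Type u) where
  times : P → P → P
  star : P → P → P
  L1 : ∀ e, times e e = e
  L2 : ∀ e f, times (times e f) e = times e f
  L3 : ∀ e f g, times e (times f g) = times (times e f) (times f g)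
  L4 : ∀ e f g, times (times e f) g = times (times e f) (times e g)
  R1 : ∀ e, star e e = e
  R2 : ∀ e f, star f e = star e (star f e)
  R3 : ∀ e f g, star (star g f) e = star (star g f) (star f e)
  R4 : ∀ e f g, star g (star f e) = star (star g e) (star f e)
  P3_star : ∀ e f g, star (star e (times f g)) g = star (star e f) g
  P3_times : ∀ e f g, times g (times (star g f) e) = times g (times f e)
  P4_times : ∀ e f, star (times e f) e = times e f
  P4_star : ∀ e f, times f (star e f) = star e f

infixl:70 " ×ₚ " => ProjectionAlgebra.times
infixl:70 " ⋆ₚ " => ProjectionAlgebra.star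

/-- Strong projection algebras. -/
class StrongProjectionAlgebra (P : Type u) extends ProjectionAlgebra P where
  SP1 : ∀ e f g : P, e ×ₚ (((e ×ₚ f) ×ₚ g) ⋆ₚ f) = (e ×ₚ f) ×ₚ g
  SP2 : ∀ e f g : P, (f ×ₚ (g ⋆ₚ (f ⋆ₚ e))) ⋆ₚ e = g ⋆ₚ (f ⋆ₚ e)

section ProjectionAlgebra

variable {P : Type u} [ProjectionAlgebra P]

open ProjectionAlgebra

/-- The natural order `e ≤_P f` of a projection algebra. -/
def PLe (e f : P) : Prop := e = f ×ₚ e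

/-- The relation `p 𝓕_P q`. -/
def PF (p q : P) : Prop := p = p ×ₚ q ∧ q = p ⋆ₚ q

/-- `e × f = f ⋆ e` for all `e`, `f`. -/
def IsSymmetricAlg (P : Type u) [ProjectionAlgebra P] : Prop := ∀ e f : P, e ×ₚ f = f ⋆ₚ e

/-- `e × f = f × e` for all `e`, `f`. -/
def IsCommutativeAlg (P : Type u) [ProjectionAlgebra P] : Prop := ∀ e f : P, e ×ₚ f = f ×ₚ e

theorem times_ple (e f : P) : PLe (e ×ₚ f) e := by
  have h := L4 e e f
  rw [L1] at h
  exact h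

theorem star_ple (e f : P) : PLe (e ⋆ₚ f) f := (P4_star e f).symm

theorem PLe.times_eq {e f : P} (h : PLe e f) : e ×ₚ f = e := by
  have h1 : e = f ×ₚ e := h
  have h2 := L2 f e
  rw [← h1] at h2
  exact h2

theorem PLe.star_eq {e f : P} (h : PLe e f) : e ⋆ₚ f = e := by
  have h1 : e = f ×ₚ e := h
  have h2 := P4_times f e
  rw [← h1] at h2
  exact h2

theorem PLe.star_eq' {e f : P} (h : PLe e f) : f ⋆ₚ e = e := by
  have h2 := R2 f e
  rw [h.star_eq] at h2
  exact h2.symm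

theorem times_star_right (e f : P) : (e ×ₚ f) ⋆ₚ f = e ⋆ₚ f := by
  have h := P3_star e e f
  rw [(times_ple e f).star_eq', R1] at h
  exact h

theorem times_star_left (e f : P) : e ×ₚ (e ⋆ₚ f) = e ×ₚ f := by
  have h := P3_times f f e
  rwa [(star_ple e f).times_eq, L1] at h

theorem times_times_self (e f : P) : (e ×ₚ f) ×ₚ f = e ×ₚ f := by
  rw [L4, L1]

theorem star_star_self (e f : P) : e ⋆ₚ (e ⋆ₚ f) = e ⋆ₚ f := by
  rw [R4, R1]

theorem PF_times_star (p q : P) : PF (p ×ₚ q) (p ⋆ₚ q) := by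
  constructor
  · have h := times_star_left (p ×ₚ q) q
    rw [times_star_right, times_times_self] at h
    exact h.symm
  · have h := times_star_right p (p ⋆ₚ q)
    rw [times_star_left, star_star_self] at h
    exact h.symm

theorem PF_refl (p : P) : PF p p := ⟨(L1 p).symm, (R1 p).symm⟩

theorem PF.symm_of_symmetric (hs : IsSymmetricAlg P) {p q : P} (h : PF p q) : PF q p :=
  ⟨h.2.trans (hs q p).symm, h.1.trans (hs p q)⟩

theorem times_of_times_of_ple {p q r : P} (h : p = p ×ₚ q) (h' : PLe q r) : p = p ×ₚ r := by
  have h1 : q = r ×ₚ q := h'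
  have h2 : p = (p ×ₚ r) ×ₚ q := by
    have h3 := L3 p r q
    rw [← h1, ← h] at h3
    exact h3
  rw [L4, ← h, L2] at h2
  exact h2

theorem star_of_star_of_ple {p q r : P} (h : p = q ⋆ₚ p) (h' : PLe q r) : p = r ⋆ₚ p := by
  have h1 : q = q ⋆ₚ r := h'.star_eq.symm
  have h2 : p = q ⋆ₚ (r ⋆ₚ p) := by
    have h3 := R3 p r q
    rw [← h1, ← h] at h3
    exact h3
  rw [R4, ← h, ← R2] at h2
  exact h2

/-! ### Paths -/

/-- `P`-paths `(p₁, …, p_k)`, `k ≥ 1`, with `p₁ 𝓕 p₂ 𝓕 ⋯ 𝓕 p_k`. -/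
@[ext]
structure PPath (P : Type u) [ProjectionAlgebra P] where
  verts : List P
  ne_nil : verts ≠ []
  chain : verts.IsChain PF

namespace PPath

def dom (p : PPath P) : P := p.verts.head p.ne_nil

def cod (p : PPath P) : P := p.verts.getLast p.ne_nil

/-- The path `(p)`. -/
def single (p : P) : PPath P := ⟨[p], by simp, by simp⟩

/-- The path `(p, q)`. -/
def pair (p q : P) (h : PF p q) : PPath P := ⟨[p, q], by simp, by simpa using h⟩

/-- The path `(p, q, s)`. -/
def triple (p q s : P) (h : PF p q) (h' : PF q s) : PPath P :=
  ⟨[p, q, s], by simp, by simpa using ⟨h, h'⟩⟩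

/-- Composition `(p₁, …, p_k = q₁, …, q_l)` in the path category. -/
def comp (p q : PPath P) (h : p.cod = q.dom) : PPath P where
  verts := p.verts ++ q.verts.tail
  ne_nil := by simp [p.ne_nil]
  chain := by
    obtain ⟨l, hl, hc⟩ := p
    obtain ⟨m, hm, hd⟩ := q
    cases m with
    | nil => exact absurd rfl hm
    | cons a m =>
      rw [List.isChain_append]
      refine ⟨hc, hd.tail, ?_⟩
      intro x hx y hy
      have hxl : x = l.getLast hl := by
        rw [List.getLast?_eq_some_getLast hl] at hx
        simpa [eq_comm] using hx
      have ha : x = a := by rw [hxl]; exact h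
      cases m with
      | nil => simp at hy
      | cons b m =>
        have hb : y = b := by simpa [eq_comm] using hy
        subst ha hb
        exact (List.isChain_cons_cons.1 hd).1

/-- The order of the path category: `p = _r⇃q` for some `r ≤_P dom q`, where
`_r⇃(q₁, …, q_k) = (r, r ⋆ q₂, (r ⋆ q₂) ⋆ q₃, …)`. -/
def Le (p q : PPath P) : Prop :=
  ∃ r : P, PLe r q.dom ∧ p.verts = q.verts.tail.scanl (· ⋆ₚ ·) r

/-- The image of a path under a map that preserves `𝓕`. -/
def map {Q : Type u} [ProjectionAlgebra Q] (φ : P → Q) (hφ : ∀ p q, PF p q → PF (φ p) (φ q))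
    (p : PPath P) : PPath Q where
  verts := p.verts.map φ
  ne_nil := by simp [p.ne_nil]
  chain := by
    rw [List.isChain_map]
    exact p.chain.imp hφ

end PPath

end ProjectionAlgebra

/-! ### Ordered categories -/

/-- Small categories presented by their set `C` of arrows: `d a`, `r a` are the identity arrows at
the source and the target of `a`, and `a ∘ b` is defined exactly if `r a = d b`. -/
class ArrowCat (C : Type u) where
  d : C → C
  r : C → C
  comp : (a b : C) → r a = d b → C
  d_comp : ∀ a b h, d (comp a b h) = d a
  r_comp : ∀ a b h, r (comp a b h) = r b
  assoc : ∀ a b c (h : r a = d b) (h' : r b = d c),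
    comp (comp a b h) c ((r_comp a b h).trans h') = comp a (comp b c h') (h.trans (d_comp b c h').symm)
  r_d : ∀ a, r (d a) = d a
  d_r : ∀ a, r a = d (r a)
  d_comp_self : ∀ a, comp (d a) a (r_d a) = a
  comp_r_self : ∀ a, comp a (r a) (d_r a) = a

open ArrowCat

/-- The set `P_C` of objects (identity arrows). -/
abbrev Obj (C : Type u) [ArrowCat C] : Type u := Set.range (d : C → C)

section

variable {C : Type u} [ArrowCat C]

def dObj (a : C) : Obj C := ⟨d a, a, rfl⟩

def rObj (a : C) : Obj C := ⟨r a, r a, (d_r a).symm⟩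

theorem d_obj (p : Obj C) : d p.1 = p.1 := by
  obtain ⟨_, a, rfl⟩ := p
  change d (d a) = d a
  have h := d_r (d a)
  rw [r_d] at h
  exact h.symm

end

/-- Every arrow is invertible. -/
def IsArrowGroupoid (C : Type u) [ArrowCat C] : Prop :=
  ∀ a : C, ∃ (b : C) (h : r a = d b) (h' : r b = d a), comp a b h = d a ∧ comp b a h' = r a

class OrderedCat (C : Type u) extends ArrowCat C, PartialOrder C where
  O1_d : ∀ a b : C, a ≤ b → d a ≤ d b
  O1_r : ∀ a b : C, a ≤ b → r a ≤ r b
  O2 : ∀ (a b c e : C) (h : r a = d c) (h' : r b = d e), a ≤ b → c ≤ e → comp a c h ≤ comp b e h'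
  O3 : ∀ (a : C) (p : Obj C), p.1 ≤ d a → ∃! x : C, x ≤ a ∧ d x = p.1
  O4 : ∀ (a : C) (q : Obj C), q.1 ≤ r a → ∃! x : C, x ≤ a ∧ r x = q.1

section

variable {C : Type u} [OrderedCat C]

/-- The left restriction `_p⇃a`, for `p ≤ d a`. -/
noncomputable def lres (p : Obj C) (a : C) (h : p.1 ≤ d a) : C := (OrderedCat.O3 a p h).choose

/-- The right restriction `a⇂_q`, for `q ≤ r a`. -/
noncomputable def rres (a : C) (q : Obj C) (h : q.1 ≤ r a) : C := (OrderedCat.O4 a q h).choose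

theorem lres_le (p : Obj C) (a : C) (h) : lres p a h ≤ a := (OrderedCat.O3 a p h).choose_spec.1.1

theorem d_lres (p : Obj C) (a : C) (h) : d (lres p a h) = p.1 :=
  (OrderedCat.O3 a p h).choose_spec.1.2

theorem rres_le (a : C) (q : Obj C) (h) : rres a q h ≤ a := (OrderedCat.O4 a q h).choose_spec.1.1

theorem r_rres (a : C) (q : Obj C) (h) : r (rres a q h) = q.1 :=
  (OrderedCat.O4 a q h).choose_spec.1.2

end

/-! ### Projection ordered categories -/

class WeakProjectionOrderedCat (C : Type u) extends OrderedCat C where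
  alg : StrongProjectionAlgebra (Obj C)
  le_iff : ∀ p q : Obj C, p.1 ≤ q.1 ↔ PLe p q

instance {C : Type u} [WeakProjectionOrderedCat C] : StrongProjectionAlgebra (Obj C) :=
  WeakProjectionOrderedCat.alg

section

variable {C : Type u} [WeakProjectionOrderedCat C]

theorem le_of_ple {p q : Obj C} (h : PLe p q) : p.1 ≤ q.1 :=
  (WeakProjectionOrderedCat.le_iff p q).2 h

/-- The map `Θ_a : x ↦ r (_{x ⋆ d a}⇃a)`. -/
noncomputable def Theta (a : C) (x : Obj C) : Obj C :=
  rObj (lres (x ⋆ₚ dObj a) a (le_of_ple (star_ple x (dObj a))))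

/-- The map `Δ_a : y ↦ d (a⇂_{r a × y})`. -/
noncomputable def Delta (a : C) (y : Obj C) : Obj C :=
  dObj (rres a (rObj a ×ₚ y) (le_of_ple (times_ple (rObj a) y)))

theorem Theta_le (a : C) (x : Obj C) : (Theta a x).1 ≤ r a :=
  OrderedCat.O1_r _ _ (lres_le _ _ _)

theorem Delta_le (a : C) (y : Obj C) : (Delta a y).1 ≤ d a :=
  OrderedCat.O1_d _ _ (rres_le _ _ _)

theorem Theta_ple (a : C) (x : Obj C) : PLe (Theta a x) (rObj a) :=
  (WeakProjectionOrderedCat.le_iff _ _).1 (Theta_le a x)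

theorem Delta_ple (a : C) (y : Obj C) : PLe (Delta a y) (dObj a) :=
  (WeakProjectionOrderedCat.le_iff _ _).1 (Delta_le a y)

end

/-- Projection ordered categories. Maps being written on the right, the two conditions read
`δ_{p Θ_a} = Δ_a δ_p Θ_a` and `θ_{p Δ_a} = Θ_a θ_p Δ_a`, where `t δ_p = p × t` and
`t θ_p = t ⋆ p`. -/
class ProjectionOrderedCat (C : Type u) extends WeakProjectionOrderedCat C where
  G1_delta : ∀ (a : C) (p t : Obj C), Theta a p ×ₚ t = Theta a (p ×ₚ Delta a t)
  G1_theta : ∀ (a : C) (p t : Obj C), t ⋆ₚ Delta a p = Delta a (Theta a t ⋆ₚ p)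

/-! ### Chain projection ordered categories -/

/-- Evaluation maps. -/
@[ext]
structure EvaluationMap (C : Type u) [ProjectionOrderedCat C] where
  toFun : PPath (Obj C) → C
  E1_single : ∀ p : Obj C, toFun (.single p) = p.1
  E1_pair : ∀ p : Obj C, toFun (.pair p p (PF_refl p)) = p.1
  E2_d : ∀ p, d (toFun p) = p.dom.1
  E2_r : ∀ p, r (toFun p) = p.cod.1
  E3 : ∀ (p q : PPath (Obj C)) (h : p.cod = q.dom), toFun (p.comp q h) =
    comp (toFun p) (toFun q) ((E2_r p).trans ((congrArg Subtype.val h).trans (E2_d q).symm))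
  E4 : ∀ p q : PPath (Obj C), p.Le q → toFun p ≤ toFun q

section

variable {C : Type u} [ProjectionOrderedCat C]

namespace EvaluationMap

/-- `ε(p, q)` for `p 𝓕 q`. -/
def two (ε : EvaluationMap C) (p q : Obj C) (h : PF p q) : C := ε.toFun (.pair p q h)

theorem d_two (ε : EvaluationMap C) (p q : Obj C) (h : PF p q) : d (ε.two p q h) = p.1 := ε.E2_d _

theorem r_two (ε : EvaluationMap C) (p q : Obj C) (h : PF p q) : r (ε.two p q h) = q.1 := ε.E2_r _

/-- `ε(e, e') ∘ x ∘ ε(f', f)` for an arrow `x` from `e'` to `f'`. -/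
def sandwich (ε : EvaluationMap C) (e e' : Obj C) (he : PF e e') (x : C) (f' f : Obj C)
    (hf : PF f' f) (hd : d x = e'.1) (hr : r x = f'.1) : C :=
  comp (comp (ε.two e e' he) x ((ε.r_two e e' he).trans hd.symm)) (ε.two f' f hf)
    ((r_comp _ _ _).trans (hr.trans (ε.d_two f' f hf).symm))

end EvaluationMap

/-- `(e, f)` is a `b`-linked pair: `f = e Θ_b θ_f` and `e = f Δ_b δ_e`. -/
structure IsLinkedPair (b : C) (e f : Obj C) : Prop where
  right : f = Theta b e ⋆ₚ f
  left : e = e ×ₚ Delta b f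

namespace IsLinkedPair

variable {b : C} {e f : Obj C}

theorem PF_e₂ (h : IsLinkedPair b e f) : PF e (Delta b f) :=
  ⟨h.left, by rw [ProjectionOrderedCat.G1_theta, ← h.right]⟩

theorem PF_f₁ (h : IsLinkedPair b e f) : PF (Theta b e) f :=
  ⟨by rw [ProjectionOrderedCat.G1_delta, ← h.left], h.right⟩

theorem PF_e₁ (h : IsLinkedPair b e f) : PF e (e ⋆ₚ dObj b) := by
  have h1 : e = e ×ₚ dObj b := times_of_times_of_ple h.left (Delta_ple b f)
  exact ⟨by rw [times_star_left, ← h1], (star_star_self _ _).symm⟩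

theorem PF_f₂ (h : IsLinkedPair b e f) : PF (rObj b ×ₚ f) f := by
  have h1 : f = rObj b ⋆ₚ f := star_of_star_of_ple h.right (Theta_ple b e)
  exact ⟨(times_times_self _ _).symm, by rw [times_star_right, ← h1]⟩

end IsLinkedPair

/-- `λ(e, b, f) = ε(e, e₁) ∘ _{e₁}⇃b ∘ ε(f₁, f)` with `e₁ = e ⋆ d b` and `f₁ = e Θ_b`. -/
noncomputable def lam (ε : EvaluationMap C) (b : C) (e f : Obj C) (h : IsLinkedPair b e f) : C :=
  ε.sandwich e (e ⋆ₚ dObj b) h.PF_e₁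
    (lres (e ⋆ₚ dObj b) b (le_of_ple (star_ple e (dObj b))))
    (Theta b e) f h.PF_f₁ (d_lres _ _ _) rfl

/-- `ρ(e, b, f) = ε(e, e₂) ∘ b⇂_{f₂} ∘ ε(f₂, f)` with `e₂ = f Δ_b` and `f₂ = r b × f`. -/
noncomputable def rho (ε : EvaluationMap C) (b : C) (e f : Obj C) (h : IsLinkedPair b e f) : C :=
  ε.sandwich e (Delta b f) h.PF_e₂
    (rres b (rObj b ×ₚ f) (le_of_ple (times_ple (rObj b) f)))
    (rObj b ×ₚ f) f h.PF_f₂ rfl (r_rres _ _ _)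

end

class ChainProjectionOrderedCat (C : Type u) extends ProjectionOrderedCat C where
  ε : EvaluationMap C
  G2 : ∀ (b : C) (e f : Obj C) (h : IsLinkedPair b e f), lam ε b e f h = rho ε b e f h

section

variable {C : Type u} [ChainProjectionOrderedCat C]

/-- The product
`a • b = a⇂_{r a × d b} ∘ ε(r a × d b, r a ⋆ d b) ∘ _{r a ⋆ d b}⇃b`. -/
noncomputable def bullet (a b : C) : C :=
  comp
    (comp (rres a (rObj a ×ₚ dObj b) (le_of_ple (times_ple (rObj a) (dObj b))))
      (ChainProjectionOrderedCat.ε.two (rObj a ×ₚ dObj b) (rObj a ⋆ₚ dObj b) (PF_times_star _ _))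
      ((r_rres _ _ _).trans (EvaluationMap.d_two _ _ _ _).symm))
    (lres (rObj a ⋆ₚ dObj b) b (le_of_ple (star_ple (rObj a) (dObj b))))
    ((r_comp _ _ _).trans ((EvaluationMap.r_two _ _ _ _).trans (d_lres _ _ _).symm))

end

/-- `P_C` is symmetric, and `ε(p, q, p) = p` whenever `p 𝓕 q`. -/
def IsSymmetricChain (C : Type u) [ChainProjectionOrderedCat C] : Prop :=
  ∃ hs : IsSymmetricAlg (Obj C), ∀ (p q : Obj C) (h : PF p q),
    ChainProjectionOrderedCat.ε.toFun (.triple p q p h (h.symm_of_symmetric hs)) = p.1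

/-- `P_C` is commutative. -/
def IsCommutativeChain (C : Type u) [ChainProjectionOrderedCat C] : Prop :=
  IsCommutativeAlg (Obj C)

/-! ### The category of chain projection ordered categories -/

/-- The map that a map commuting with `d` induces on objects. -/
def objMap {C D : Type u} [ArrowCat C] [ArrowCat D] (φ : C → D) (h : ∀ a, d (φ a) = φ (d a))
    (p : Obj C) : Obj D :=
  ⟨φ p.1, φ p.1, by rw [h, d_obj]⟩

/-- Chain projection ordered functors. -/
@[ext]
structure ChainFunctor (C D : Type u) [ChainProjectionOrderedCat C]
    [ChainProjectionOrderedCat D] where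
  toFun : C → D
  F1_d : ∀ a, d (toFun a) = toFun (d a)
  F1_r : ∀ a, r (toFun a) = toFun (r a)
  F2 : ∀ (a b : C) (h : r a = d b), toFun (comp a b h) =
    comp (toFun a) (toFun b) ((F1_r a).trans ((congrArg toFun h).trans (F1_d b).symm))
  F3 : ∀ a b : C, a ≤ b → toFun a ≤ toFun b
  F4_times : ∀ e f : Obj C,
    objMap toFun F1_d (e ×ₚ f) = objMap toFun F1_d e ×ₚ objMap toFun F1_d f
  F4_star : ∀ e f : Obj C,
    objMap toFun F1_d (e ⋆ₚ f) = objMap toFun F1_d e ⋆ₚ objMap toFun F1_d f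
  F5 : ∀ p : PPath (Obj C), toFun (ChainProjectionOrderedCat.ε.toFun p) =
    ChainProjectionOrderedCat.ε.toFun (p.map (objMap toFun F1_d) fun p q h =>
      ⟨(congrArg (objMap toFun F1_d) h.1).trans (F4_times p q),
        (congrArg (objMap toFun F1_d) h.2).trans (F4_star p q)⟩)

def ChainFunctor.id (C : Type u) [ChainProjectionOrderedCat C] : ChainFunctor C C where
  toFun a := a
  F1_d _ := rfl
  F1_r _ := rfl
  F2 _ _ _ := rfl
  F3 _ _ h := h
  F4_times _ _ := rfl
  F4_star _ _ := rfl
  F5 _ := congrArg ChainProjectionOrderedCat.ε.toFun (PPath.ext (List.map_id _).symm)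

def ChainFunctor.comp {C D E : Type u} [ChainProjectionOrderedCat C]
    [ChainProjectionOrderedCat D] [ChainProjectionOrderedCat E]
    (φ : ChainFunctor C D) (ψ : ChainFunctor D E) : ChainFunctor C E where
  toFun a := ψ.toFun (φ.toFun a)
  F1_d a := by rw [ψ.F1_d, φ.F1_d]
  F1_r a := by rw [ψ.F1_r, φ.F1_r]
  F2 a b h := by simp only [φ.F2, ψ.F2]
  F3 a b h := ψ.F3 _ _ (φ.F3 _ _ h)
  F4_times e f := (congrArg (objMap ψ.toFun ψ.F1_d) (φ.F4_times e f)).trans (ψ.F4_times _ _)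
  F4_star e f := (congrArg (objMap ψ.toFun ψ.F1_d) (φ.F4_star e f)).trans (ψ.F4_star _ _)
  F5 p := by
    simp only [φ.F5, ψ.F5]
    congr 1
    exact PPath.ext (List.map_map)

/-- Chain projection ordered categories; arrow sets are nonempty. -/
structure CPOC : Type (u + 1) where
  carrier : Type u
  nonempty : Nonempty carrier
  str : ChainProjectionOrderedCat carrier

instance (C : CPOC.{u}) : ChainProjectionOrderedCat C.carrier := C.str

instance : Category CPOC.{u} where
  Hom C D := ChainFunctor C.carrier D.carrier
  id C := ChainFunctor.id C.carrier
  comp φ ψ := φ.comp ψ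

/-- The underlying set functor. -/
def CPOC.underlying : CPOC.{u} ⥤ Type u where
  obj C := C.carrier
  map φ := TypeCat.ofHom φ.toFun

/-- Chain projection ordered groupoids. -/
def CPOC.isGroupoid : ObjectProperty CPOC.{u} := fun C => IsArrowGroupoid C.carrier

/-- Symmetric chain projection ordered categories. -/
def CPOC.isSymmetric : ObjectProperty CPOC.{u} := fun C => IsSymmetricChain C.carrier

/-- Commutative chain projection ordered categories. -/
def CPOC.isCommutative : ObjectProperty CPOC.{u} := fun C => IsCommutativeChain C.carrier

/-- Symmetric chain projection ordered groupoids. -/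
def CPOC.isSymmetricGroupoid : ObjectProperty CPOC.{u} :=
  fun C => IsSymmetricChain C.carrier ∧ IsArrowGroupoid C.carrier

/-- Commutative chain projection ordered groupoids. -/
def CPOC.isCommutativeGroupoid : ObjectProperty CPOC.{u} :=
  fun C => IsCommutativeChain C.carrier ∧ IsArrowGroupoid C.carrier

/-! ### Classes of semigroups -/

/-- Semigroups with two unary operations `x ↦ x⁺` and `x ↦ x*`. -/
class BiunarySemigroup (S : Type u) extends Semigroup S where
  plus : S → S
  ast : S → S

postfix:max "⁺ˢ" => BiunarySemigroup.plus
postfix:max "∗ˢ" => BiunarySemigroup.ast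

/-- DRC-restriction semigroups. -/
class DRCRestrictionSemigroup (S : Type u) extends BiunarySemigroup S where
  plus_mul_self : ∀ x : S, x⁺ˢ * x = x
  mul_ast_self : ∀ x : S, x * x∗ˢ = x
  plus_mul : ∀ x y : S, (x * y)⁺ˢ = (x * y⁺ˢ)⁺ˢ
  ast_mul : ∀ x y : S, (x * y)∗ˢ = (x∗ˢ * y)∗ˢ
  plus_mul_eq : ∀ x y : S, (x * y)⁺ˢ = x⁺ˢ * (x * y)⁺ˢ * x⁺ˢ
  ast_mul_eq : ∀ x y : S, (x * y)∗ˢ = y∗ˢ * (x * y)∗ˢ * y∗ˢ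
  plus_plus : ∀ x : S, x⁺ˢ⁺ˢ = x⁺ˢ
  ast_ast : ∀ x : S, x∗ˢ∗ˢ = x∗ˢ
  plus_ast : ∀ x : S, x⁺ˢ∗ˢ = x⁺ˢ
  ast_plus : ∀ x : S, x∗ˢ⁺ˢ = x∗ˢ
  ample_ast : ∀ x y : S, x * (y * x)∗ˢ = (y * x⁺ˢ)∗ˢ * x
  ample_plus : ∀ x y : S, (x * y)⁺ˢ * x = x * (x∗ˢ * y)⁺ˢ

/-- `P`-restriction semigroups. -/
class PRestrictionSemigroup (S : Type u) extends BiunarySemigroup S where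
  plus_mul_self : ∀ x : S, x⁺ˢ * x = x
  plus_mul : ∀ x y : S, (x * y)⁺ˢ = (x * y⁺ˢ)⁺ˢ
  plus_proj : ∀ x y : S, (x⁺ˢ * y⁺ˢ)⁺ˢ = x⁺ˢ * y⁺ˢ * x⁺ˢ
  plus_idem : ∀ x : S, x⁺ˢ * x⁺ˢ = x⁺ˢ
  plus_ast : ∀ x : S, x⁺ˢ∗ˢ = x⁺ˢ
  mul_ast_self : ∀ x : S, x * x∗ˢ = x
  ast_mul : ∀ x y : S, (x * y)∗ˢ = (x∗ˢ * y)∗ˢ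
  ast_proj : ∀ x y : S, (x∗ˢ * y∗ˢ)∗ˢ = y∗ˢ * x∗ˢ * y∗ˢ
  ast_idem : ∀ x : S, x∗ˢ * x∗ˢ = x∗ˢ
  ast_plus : ∀ x : S, x∗ˢ⁺ˢ = x∗ˢ
  ample_plus : ∀ x y : S, (x * y)⁺ˢ * x = x * y⁺ˢ * x∗ˢ
  ample_ast : ∀ x y : S, x * (y * x)∗ˢ = x⁺ˢ * y∗ˢ * x

/-- Restriction semigroups, as algebras `(S, ·, ⁺, *)`. -/
class RestrictionSemigroup (S : Type u) extends BiunarySemigroup S where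
  plus_mul_self : ∀ x : S, x⁺ˢ * x = x
  plus_comm : ∀ x y : S, x⁺ˢ * y⁺ˢ = y⁺ˢ * x⁺ˢ
  plus_proj : ∀ x y : S, y⁺ˢ * x⁺ˢ = (x⁺ˢ * y⁺ˢ)⁺ˢ
  plus_mul_le : ∀ x y : S, x⁺ˢ * (x * y)⁺ˢ = (x * y)⁺ˢ
  plus_mul : ∀ x y : S, (x * y)⁺ˢ = (x * y⁺ˢ)⁺ˢ
  plus_ast : ∀ x : S, x⁺ˢ∗ˢ = x⁺ˢ
  mul_ast_self : ∀ x : S, x * x∗ˢ = x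
  ast_comm : ∀ x y : S, x∗ˢ * y∗ˢ = y∗ˢ * x∗ˢ
  ast_proj : ∀ x y : S, y∗ˢ * x∗ˢ = (x∗ˢ * y∗ˢ)∗ˢ
  ast_mul_le : ∀ x y : S, (x * y)∗ˢ * y∗ˢ = (x * y)∗ˢ
  ast_mul : ∀ x y : S, (x * y)∗ˢ = (x∗ˢ * y)∗ˢ
  ast_plus : ∀ x : S, x∗ˢ⁺ˢ = x∗ˢ
  ample_plus : ∀ x y : S, (x * y)⁺ˢ * x = x * y⁺ˢ
  ample_ast : ∀ x y : S, x * (y * x)∗ˢ = y∗ˢ * x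

/-- Semigroups with a unary operation `x ↦ x°`. -/
class UnarySemigroup (S : Type u) extends Semigroup S where
  circ : S → S

postfix:max "°ˢ" => UnarySemigroup.circ

/-- Generalized regular ∘-semigroups. -/
class GenRegularCircSemigroup (S : Type u) extends UnarySemigroup S where
  mul_circ_mul : ∀ x : S, x * x°ˢ * x = x
  circ_circ : ∀ x : S, x°ˢ°ˢ = x
  circ_mul_right : ∀ x y : S, (x * y)°ˢ = (x * y)°ˢ * x * x°ˢ
  circ_mul_left : ∀ x y : S, (x * y)°ˢ = y°ˢ * y * (x * y)°ˢ
  circ_mul_self : ∀ x y : S, (x * y)°ˢ * x = (x°ˢ * x * y)°ˢ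

/-- Regular ∘-semigroups. -/
class RegularCircSemigroup (S : Type u) extends UnarySemigroup S where
  mul_circ_mul : ∀ x : S, x * x°ˢ * x = x
  circ_circ : ∀ x : S, x°ˢ°ˢ = x
  circ_mul : ∀ x y : S, (x * y)°ˢ = y°ˢ * x°ˢ

/-- Inverse semigroups: regular semigroups whose idempotents commute. -/
class InverseSemigroup (S : Type u) extends Semigroup S where
  regular : ∀ x : S, ∃ a : S, x * a * x = x ∧ a * x * a = a
  idem_comm : ∀ e f : S, e * e = e → f * f = f → e * f = f * e

/-! ### Each of the classes yields DRC-restriction semigroups -/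

/-- A `P`-restriction semigroup is DRC-restriction. -/
@[reducible]
def PRestrictionSemigroup.toDRC {S : Type u} (h : PRestrictionSemigroup S) :
    DRCRestrictionSemigroup S where
  toBiunarySemigroup := h.toBiunarySemigroup
  plus_mul_self := h.plus_mul_self
  mul_ast_self := h.mul_ast_self
  plus_mul := h.plus_mul
  ast_mul := h.ast_mul
  plus_mul_eq x y := by
    have h1 := h.plus_mul x⁺ˢ (x * y)
    rwa [← mul_assoc, h.plus_mul_self, h.plus_proj] at h1
  ast_mul_eq x y := by
    have h1 := h.ast_mul (x * y) y∗ˢ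
    rwa [mul_assoc, h.mul_ast_self, h.ast_proj] at h1
  plus_plus x := by
    have := h.plus_proj x x
    simpa only [h.plus_idem] using this
  ast_ast x := by
    have := h.ast_proj x x
    simpa only [h.ast_idem] using this
  plus_ast := h.plus_ast
  ast_plus := h.ast_plus
  ample_ast x y := by
    have h1 := h.ast_proj y x⁺ˢ
    rw [h.plus_ast, ← h.ast_mul] at h1
    rw [h1, h.ample_ast, mul_assoc, mul_assoc, mul_assoc, h.plus_mul_self]
  ample_plus x y := by
    have h1 := h.plus_proj x∗ˢ y
    rw [h.ast_plus, ← h.plus_mul] at h1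
    rw [h1, h.ample_plus, ← mul_assoc, ← mul_assoc, h.mul_ast_self]

/-- A restriction semigroup is DRC-restriction. -/
@[reducible]
def RestrictionSemigroup.toDRC {S : Type u} (h : RestrictionSemigroup S) :
    DRCRestrictionSemigroup S :=
  have pp : ∀ x : S, x⁺ˢ⁺ˢ = x⁺ˢ := fun x => by
    have h1 := h.ast_plus x⁺ˢ
    rwa [h.plus_ast] at h1
  have aa : ∀ x : S, x∗ˢ∗ˢ = x∗ˢ := fun x => by
    have h1 := h.plus_ast x∗ˢ
    rwa [h.ast_plus] at h1
  { toBiunarySemigroup := h.toBiunarySemigroup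
    plus_mul_self := h.plus_mul_self
    mul_ast_self := h.mul_ast_self
    plus_mul := h.plus_mul
    ast_mul := h.ast_mul
    plus_mul_eq := fun x y => by
      rw [h.plus_mul_le, h.plus_comm, h.plus_mul_le]
    ast_mul_eq := fun x y => by
      rw [mul_assoc, h.ast_mul_le, h.ast_comm, h.ast_mul_le]
    plus_plus := pp
    ast_ast := aa
    plus_ast := h.plus_ast
    ast_plus := h.ast_plus
    ample_ast := fun x y => by
      have h1 := h.ast_proj y x⁺ˢ
      rw [h.plus_ast, ← h.ast_mul] at h1
      have h2 := h.ast_comm y x⁺ˢ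
      rw [h.plus_ast] at h2
      rw [← h1, ← h2, mul_assoc, h.plus_mul_self, h.ample_ast]
    ample_plus := fun x y => by
      have h1 := h.plus_proj x∗ˢ y
      rw [h.ast_plus, ← h.plus_mul] at h1
      have h2 := h.plus_comm x∗ˢ y
      rw [h.ast_plus] at h2
      rw [← h1, ← h2, ← mul_assoc, h.mul_ast_self, h.ample_plus] }

section GenRegular

variable {S : Type u}

theorem GenRegularCircSemigroup.circ_mul_circ [h : GenRegularCircSemigroup S] (x : S) :
    x°ˢ * x * x°ˢ = x°ˢ := by
  have h1 := h.mul_circ_mul x°ˢ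
  rwa [h.circ_circ] at h1

theorem GenRegularCircSemigroup.mul_circ_self [h : GenRegularCircSemigroup S] (x y : S) :
    y * (x * y)°ˢ = (x * y * y°ˢ)°ˢ := by
  have h1 := h.circ_mul_self y (x * y)°ˢ
  rw [← h.circ_mul_left, h.circ_circ] at h1
  have h2 := h.circ_mul_right y (x * y)°ˢ
  rw [h1] at h2
  rw [← h2, h.circ_circ]

theorem GenRegularCircSemigroup.circ_plus [h : GenRegularCircSemigroup S] (x : S) :
    (x * x°ˢ)°ˢ = x * x°ˢ := by
  have h1 := h.circ_mul_self x x°ˢ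
  rw [circ_mul_circ, h.circ_circ] at h1
  have h2 := h.circ_mul_right x x°ˢ
  rwa [h1] at h2

theorem GenRegularCircSemigroup.circ_ast [h : GenRegularCircSemigroup S] (x : S) :
    (x°ˢ * x)°ˢ = x°ˢ * x := by
  have h1 := circ_plus x°ˢ
  rwa [h.circ_circ] at h1

/-- A generalized regular ∘-semigroup is DRC-restriction with `x⁺ = x x°`, `x* = x° x`. -/
@[reducible]
def GenRegularCircSemigroup.toDRC (h : GenRegularCircSemigroup S) :
    DRCRestrictionSemigroup S where
  toSemigroup := h.toSemigroup
  plus x := x * x°ˢ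
  ast x := x°ˢ * x
  plus_mul_self x := h.mul_circ_mul x
  mul_ast_self x := by rw [← mul_assoc, h.mul_circ_mul]
  plus_mul x y := by
    have h1 := mul_circ_self x y
    rw [← mul_assoc x y, ← h1]
    simp only [mul_assoc]
    rw [← mul_assoc y°ˢ, ← h.circ_mul_left]
  ast_mul x y := by
    rw [← h.circ_mul_self x y]
    simp only [← mul_assoc]
    rw [← h.circ_mul_right]
  plus_mul_eq x y := by
    have h1 := h.circ_mul_right x y
    have h2 : x * x°ˢ * (x * y) = x * y := by rw [← mul_assoc, h.mul_circ_mul]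
    rw [← mul_assoc (x * x°ˢ), h2, mul_assoc (x * y), ← mul_assoc (x * y)°ˢ, ← h1]
  ast_mul_eq x y := by
    have h1 := h.circ_mul_left x y
    have h2 : x * y * (y°ˢ * y) = x * y := by
      rw [mul_assoc, ← mul_assoc y, h.mul_circ_mul]
    rw [← mul_assoc (y°ˢ * y), ← h1, mul_assoc, h2]
  plus_plus x := by rw [circ_plus, ← mul_assoc, h.mul_circ_mul]
  ast_ast x := by rw [circ_ast, ← mul_assoc, circ_mul_circ]
  plus_ast x := by rw [circ_plus, ← mul_assoc, h.mul_circ_mul]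
  ast_plus x := by rw [circ_ast, ← mul_assoc, circ_mul_circ]
  ample_ast x y := by
    have h1 := mul_circ_self y x
    rw [← mul_assoc y x, ← h1, ← mul_assoc x (y * x)°ˢ]
    simp only [mul_assoc]
    rw [← mul_assoc x x°ˢ x, h.mul_circ_mul]
  ample_plus x y := by
    rw [← h.circ_mul_self x y]
    simp only [← mul_assoc]
    rw [h.mul_circ_mul]

end GenRegular

/-- A regular ∘-semigroup is a generalized regular ∘-semigroup. -/
@[reducible]
def RegularCircSemigroup.toGenRegular {S : Type u} (h : RegularCircSemigroup S) :
    GenRegularCircSemigroup S :=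
  have hc : ∀ x : S, x°ˢ * x * x°ˢ = x°ˢ := fun x => by
    have h1 := h.mul_circ_mul x°ˢ
    rwa [h.circ_circ] at h1
  { toUnarySemigroup := h.toUnarySemigroup
    mul_circ_mul := h.mul_circ_mul
    circ_circ := h.circ_circ
    circ_mul_right := fun x y => by
      rw [h.circ_mul, mul_assoc, mul_assoc, ← mul_assoc x°ˢ, hc]
    circ_mul_left := fun x y => by
      rw [h.circ_mul, ← mul_assoc, hc]
    circ_mul_self := fun x y => by
      rw [h.circ_mul, h.circ_mul, h.circ_mul, h.circ_circ, mul_assoc] }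

section Inverse

variable {S : Type u} [InverseSemigroup S]

/-- The inverse `x⁻¹` of an element of an inverse semigroup. -/
noncomputable def invElt (x : S) : S := (InverseSemigroup.regular x).choose

theorem mul_invElt_mul (x : S) : x * invElt x * x = x :=
  (InverseSemigroup.regular x).choose_spec.1

theorem invElt_mul_invElt (x : S) : invElt x * x * invElt x = invElt x :=
  (InverseSemigroup.regular x).choose_spec.2

theorem inverse_unique {x a b : S} (ha : x * a * x = x) (ha' : a * x * a = a)
    (hb : x * b * x = x) (hb' : b * x * b = b) : a = b := by
  have e1 : (x * a) * (x * a) = x * a := by rw [← mul_assoc, ha]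
  have e2 : (x * b) * (x * b) = x * b := by rw [← mul_assoc, hb]
  have e3 : (a * x) * (a * x) = a * x := by rw [← mul_assoc, ha']
  have e4 : (b * x) * (b * x) = b * x := by rw [← mul_assoc, hb']
  have c1 := InverseSemigroup.idem_comm _ _ e1 e2
  have c2 := InverseSemigroup.idem_comm _ _ e3 e4
  have h1 : x * a = x * b := by
    have h2 : x * b * (x * a) = x * a := by rw [← mul_assoc, hb]
    have h3 : x * a * (x * b) = x * b := by rw [← mul_assoc, ha]
    rw [← h2, ← c1, h3]
  have h4 : a * x = b * x := by
    have h2 : a * x * (b * x) = a * x := by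
      rw [mul_assoc, ← mul_assoc x, hb]
    have h3 : b * x * (a * x) = b * x := by
      rw [mul_assoc, ← mul_assoc x, ha]
    rw [← h2, c2, h3]
  rw [← ha', h4, mul_assoc, h1, ← mul_assoc, hb']

theorem eq_invElt {x a : S} (ha : x * a * x = x) (ha' : a * x * a = a) : a = invElt x :=
  inverse_unique ha ha' (mul_invElt_mul x) (invElt_mul_invElt x)

end Inverse

/-- An inverse semigroup is a regular ∘-semigroup with `x° = x⁻¹`. -/
@[reducible]
noncomputable def InverseSemigroup.toRegularCirc {S : Type u} (h : InverseSemigroup S) :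
    RegularCircSemigroup S where
  toSemigroup := h.toSemigroup
  circ := invElt
  mul_circ_mul := mul_invElt_mul
  circ_circ x := (eq_invElt (invElt_mul_invElt x) (mul_invElt_mul x)).symm
  circ_mul x y := by
    have e1 : (y * invElt y) * (y * invElt y) = y * invElt y := by
      rw [← mul_assoc, mul_invElt_mul]
    have e2 : (invElt x * x) * (invElt x * x) = invElt x * x := by
      rw [← mul_assoc, invElt_mul_invElt]
    have c := h.idem_comm _ _ e1 e2
    symm
    apply eq_invElt
    · calc x * y * (invElt y * invElt x) * (x * y)
          = x * ((y * invElt y) * (invElt x * x)) * y := by simp only [mul_assoc]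
        _ = (x * invElt x * x) * (y * invElt y * y) := by rw [c]; simp only [mul_assoc]
        _ = x * y := by rw [mul_invElt_mul, mul_invElt_mul]
    · calc invElt y * invElt x * (x * y) * (invElt y * invElt x)
          = invElt y * ((invElt x * x) * (y * invElt y)) * invElt x := by simp only [mul_assoc]
        _ = (invElt y * y * invElt y) * (invElt x * x * invElt x) := by
            rw [← c]; simp only [mul_assoc]
        _ = invElt y * invElt x := by rw [invElt_mul_invElt, invElt_mul_invElt]

/-! ### The categories of semigroups -/

/-- (2,1,1)-homomorphisms. -/
@[ext]
structure BiunaryHom (S T : Type u) [BiunarySemigroup S] [BiunarySemigroup T] where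
  toFun : S → T
  map_mul : ∀ x y, toFun (x * y) = toFun x * toFun y
  map_plus : ∀ x, toFun x⁺ˢ = (toFun x)⁺ˢ
  map_ast : ∀ x, toFun x∗ˢ = (toFun x)∗ˢ

/-- DRC-restriction semigroups; semigroups are nonempty. -/
structure DRS : Type (u + 1) where
  carrier : Type u
  nonempty : Nonempty carrier
  str : DRCRestrictionSemigroup carrier

instance (S : DRS.{u}) : DRCRestrictionSemigroup S.carrier := S.str

/-- The category of DRC-restriction semigroups and (2,1,1)-homomorphisms. -/
instance : Category DRS.{u} where
  Hom S T := BiunaryHom S.carrier T.carrier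
  id S := ⟨fun x => x, fun _ _ => rfl, fun _ => rfl, fun _ => rfl⟩
  comp φ ψ :=
    { toFun := fun x => ψ.toFun (φ.toFun x)
      map_mul := fun x y => by rw [φ.map_mul, ψ.map_mul]
      map_plus := fun x => by rw [φ.map_plus, ψ.map_plus]
      map_ast := fun x => by rw [φ.map_ast, ψ.map_ast] }

/-- The underlying set functor. -/
def DRS.underlying : DRS.{u} ⥤ Type u where
  obj S := S.carrier
  map φ := TypeCat.ofHom φ.toFun

structure GenRegularCirc : Type (u + 1) where
  carrier : Type u
  nonempty : Nonempty carrier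
  str : GenRegularCircSemigroup carrier

structure PRestriction : Type (u + 1) where
  carrier : Type u
  nonempty : Nonempty carrier
  str : PRestrictionSemigroup carrier

structure RegularCirc : Type (u + 1) where
  carrier : Type u
  nonempty : Nonempty carrier
  str : RegularCircSemigroup carrier

structure Restriction : Type (u + 1) where
  carrier : Type u
  nonempty : Nonempty carrier
  str : RestrictionSemigroup carrier

structure Inverse : Type (u + 1) where
  carrier : Type u
  nonempty : Nonempty carrier
  str : InverseSemigroup carrier

def GenRegularCirc.toDRS (S : GenRegularCirc.{u}) : DRS.{u} :=
  ⟨S.carrier, S.nonempty, S.str.toDRC⟩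

def PRestriction.toDRS (S : PRestriction.{u}) : DRS.{u} :=
  ⟨S.carrier, S.nonempty, S.str.toDRC⟩

def RegularCirc.toDRS (S : RegularCirc.{u}) : DRS.{u} :=
  ⟨S.carrier, S.nonempty, S.str.toGenRegular.toDRC⟩

def Restriction.toDRS (S : Restriction.{u}) : DRS.{u} :=
  ⟨S.carrier, S.nonempty, S.str.toDRC⟩

noncomputable def Inverse.toDRS (S : Inverse.{u}) : DRS.{u} :=
  ⟨S.carrier, S.nonempty, S.str.toRegularCirc.toGenRegular.toDRC⟩

/-- The category of generalized regular ∘-semigroups and maps that are (2,1,1)-homomorphisms for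
`x⁺ = x x°` and `x* = x° x`. -/
abbrev GenRegularCircCat : Type (u + 1) := InducedCategory DRS.{u} GenRegularCirc.toDRS

/-- The category of `P`-restriction semigroups and (2,1,1)-homomorphisms. -/
abbrev PRestrictionCat : Type (u + 1) := InducedCategory DRS.{u} PRestriction.toDRS

/-- The category of regular ∘-semigroups and maps that are (2,1,1)-homomorphisms for `x⁺ = x x°`
and `x* = x° x`. -/
abbrev RegularCircCat : Type (u + 1) := InducedCategory DRS.{u} RegularCirc.toDRS

/-- The category of restriction semigroups and (2,1,1)-homomorphisms. -/
abbrev RestrictionCat : Type (u + 1) := InducedCategory DRS.{u} Restriction.toDRS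

/-- The category of inverse semigroups and maps that are (2,1,1)-homomorphisms for
`x⁺ = x x⁻¹` and `x* = x⁻¹ x`. -/
abbrev InverseCat : Type (u + 1) := InducedCategory DRS.{u} Inverse.toDRS

/-! ### The correspondence -/

/-- `C` is the chain projection ordered category of the DRC-restriction semigroup `S`: it has the
same underlying set, `d x = x⁺`, `r x = x*`, `∘` is the restricted product, `≤` is the natural
partial order, `e × f = (e f)⁺`, `e ⋆ f = (e f)*` and `ε(p₁, …, p_k) = p₁ ⋯ p_k`. -/
def IsChainCatOf (S : DRS.{u}) (C : CPOC.{u}) : Prop :=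
  ∃ str : ChainProjectionOrderedCat S.carrier, C = ⟨S.carrier, S.nonempty, str⟩ ∧
    (∀ x : S.carrier, d x = x⁺ˢ) ∧
    (∀ x : S.carrier, r x = x∗ˢ) ∧
    (∀ (x y : S.carrier) (h : r x = d y), comp x y h = x * y) ∧
    (∀ x y : S.carrier, x ≤ y ↔ x = x⁺ˢ * y ∧ y⁺ˢ * x⁺ˢ * y⁺ˢ = x⁺ˢ) ∧
    (∀ e f : Obj S.carrier, (e ×ₚ f).1 = (e.1 * f.1)⁺ˢ) ∧
    (∀ e f : Obj S.carrier, (e ⋆ₚ f).1 = (e.1 * f.1)∗ˢ) ∧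
    (∀ p : PPath (Obj S.carrier),
      ChainProjectionOrderedCat.ε.toFun p = p.verts.tail.foldl (fun x q => x * q.1) p.dom.1)

/-- `S` is the DRC-restriction semigroup of the chain projection ordered category `C`: it has the
same underlying set, its product is `•`, and `x⁺ = d x`, `x* = r x`. -/
def IsSemigroupOf (C : CPOC.{u}) (S : DRS.{u}) : Prop :=
  ∃ str : DRCRestrictionSemigroup C.carrier, S = ⟨C.carrier, C.nonempty, str⟩ ∧
    (∀ x y : C.carrier, x * y = bullet x y) ∧
    (∀ x : C.carrier, x⁺ˢ = d x) ∧
    (∀ x : C.carrier, x∗ˢ = r x)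

/-- The functors `F : A ⥤ B` and `G : B ⥤ A` are mutually inverse. -/
def MutuallyInverse {A B : Type (u + 1)} [Category.{u} A] [Category.{u} B]
    (F : A ⥤ B) (G : B ⥤ A) : Prop :=
  F ⋙ G = 𝟭 A ∧ G ⋙ F = 𝟭 B

/-- `F` and `G` restrict, along `i : X ⥤ A` and `j : Y ⥤ B`, to mutually inverse functors between
`X` and `Y`. -/
def RestrictToIso {A B X Y : Type (u + 1)} [Category.{u} A] [Category.{u} B] [Category.{u} X]
    [Category.{u} Y] (F : A ⥤ B) (G : B ⥤ A) (i : X ⥤ A) (j : Y ⥤ B) : Prop :=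
  ∃ (F' : X ⥤ Y) (G' : Y ⥤ X), MutuallyInverse F' G' ∧ F' ⋙ j = i ⋙ F ∧ G' ⋙ i = j ⋙ G

end ChainPO

/-!
An arrow of `𝐂(S)` is an element of `S`, so both functors are the identity on sets and on maps, and
they are mutually inverse as soon as the operations of `𝐒(𝐂(S))` and of `𝐂(𝐒(C))` are the original
ones.

The product `•` is associative because of the linked pair axiom. Given `a`, `b`, `c`, put
`e = 𝐫(a) × 𝐝(c)Δ_b` and `f = 𝐫(a)Θ_b ⋆ 𝐝(c)`. These form a linked pair for `b`, and with the
restrictions `u ≤ a` and `w ≤ c` with target `e` and source `f` one finds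
`(a • b) • c = u ∘ λ(e, b, f) ∘ w` and `a • (b • c) = u ∘ ρ(e, b, f) ∘ w`, where `λ` and `ρ` denote
the two sides of the axiom. Conversely, in a semigroup both `λ(e, b, f)` and `ρ(e, b, f)` are the
product `e b f`.

Inside DRC-restriction semigroups the five classes are cut out by combinations of three conditions:
every element has an inverse for the restricted product, projections satisfy `(e f)⁺ = e f e`, and
projections commute. These say that `𝐂(S)` is a groupoid, symmetric and commutative, respectively.
-/

namespace ChainPO

open ArrowCat MulOpposite

/-! ### Projections and the natural order of a DRC-restriction semigroup -/

section DRC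

variable {S : Type u} [DRCRestrictionSemigroup S]

open DRCRestrictionSemigroup

/-- The opposite of a DRC-restriction semigroup, where `⁺` and `*` are interchanged. The starred
half of a left-right dual pair of statements is obtained by applying the other half to it. -/
instance : DRCRestrictionSemigroup Sᵐᵒᵖ where
  plus x := op (unop x)∗ˢ
  ast x := op (unop x)⁺ˢ
  plus_mul_self x := congrArg op (mul_ast_self (unop x))
  mul_ast_self x := congrArg op (plus_mul_self (unop x))
  plus_mul x y := congrArg op (ast_mul (unop y) (unop x))
  ast_mul x y := congrArg op (plus_mul (unop y) (unop x))
  plus_mul_eq x y := congrArg op ((ast_mul_eq (unop y) (unop x)).trans (mul_assoc _ _ _))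
  ast_mul_eq x y := congrArg op ((plus_mul_eq (unop y) (unop x)).trans (mul_assoc _ _ _))
  plus_plus x := congrArg op (ast_ast (unop x))
  ast_ast x := congrArg op (plus_plus (unop x))
  plus_ast x := congrArg op (ast_plus (unop x))
  ast_plus x := congrArg op (plus_ast (unop x))
  ample_ast x y := congrArg op (ample_plus (unop x) (unop y))
  ample_plus x y := congrArg op (ample_ast (unop x) (unop y))

theorem plus_idem (x : S) : x⁺ˢ * x⁺ˢ = x⁺ˢ := by
  simpa only [plus_plus] using plus_mul_self x⁺ˢ

theorem ast_idem (x : S) : x∗ˢ * x∗ˢ = x∗ˢ := congrArg unop (plus_idem (op x))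

theorem plus_mul_plus_mul (x y : S) : x⁺ˢ * (x * y)⁺ˢ = (x * y)⁺ˢ := by
  rw [plus_mul_eq x y, ← mul_assoc, ← mul_assoc, plus_idem]

theorem plus_mul_mul_plus (x y : S) : (x * y)⁺ˢ * x⁺ˢ = (x * y)⁺ˢ := by
  rw [plus_mul_eq x y, mul_assoc, plus_idem]

theorem ast_mul_ast_mul (x y : S) : y∗ˢ * (x * y)∗ˢ = (x * y)∗ˢ :=
  congrArg unop (plus_mul_mul_plus (op y) (op x))

theorem plus_mul_of_ast_eq {x y : S} (h : x∗ˢ = y⁺ˢ) : (x * y)⁺ˢ = x⁺ˢ := by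
  rw [plus_mul, ← h, mul_ast_self]

theorem ast_mul_of_ast_eq {x y : S} (h : x∗ˢ = y⁺ˢ) : (x * y)∗ˢ = y∗ˢ :=
  congrArg unop (plus_mul_of_ast_eq (x := op y) (y := op x) (congrArg op h.symm))

/-- Projections: the elements of the form `x⁺`, equivalently of the form `x*`. -/
def IsProj (e : S) : Prop := e⁺ˢ = e

theorem isProj_plus (x : S) : IsProj x⁺ˢ := plus_plus x

theorem isProj_ast (x : S) : IsProj x∗ˢ := ast_plus x

namespace IsProj

variable {e f g : S}

theorem plus_eq (he : IsProj e) : e⁺ˢ = e := he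

theorem ast_eq (he : IsProj e) : e∗ˢ = e := by
  simpa only [he.plus_eq] using plus_ast e

theorem op (he : IsProj e) : IsProj (op e) := congrArg MulOpposite.op he.ast_eq

theorem idem (he : IsProj e) : e * e = e := by
  simpa only [he.plus_eq] using plus_mul_self e

theorem mul_plus_mul (he : IsProj e) (y : S) : e * (e * y)⁺ˢ = (e * y)⁺ˢ := by
  simpa only [he.plus_eq] using plus_mul_plus_mul e y

theorem plus_mul_mul (he : IsProj e) (y : S) : (e * y)⁺ˢ * e = (e * y)⁺ˢ := by
  simpa only [he.plus_eq] using plus_mul_mul_plus e y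

theorem plus_mul_cancel (he : IsProj e) (y : S) : (e * y)⁺ˢ * y = e * y := by
  rw [← he.plus_mul_mul, mul_assoc, plus_mul_self]

theorem mul_ast_mul (hf : IsProj f) (x : S) : f * (x * f)∗ˢ = (x * f)∗ˢ :=
  congrArg unop (hf.op.plus_mul_mul (MulOpposite.op x))

theorem ast_mul_mul (hf : IsProj f) (x : S) : (x * f)∗ˢ * f = (x * f)∗ˢ :=
  congrArg unop (hf.op.mul_plus_mul (MulOpposite.op x))

theorem mul_ast_cancel (hf : IsProj f) (x : S) : x * (x * f)∗ˢ = x * f :=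
  congrArg unop (hf.op.plus_mul_cancel (MulOpposite.op x))

theorem plus_mul_plus_left (he : IsProj e) (x y : S) :
    (e * (x * y)⁺ˢ)⁺ˢ = ((e * x)⁺ˢ * (x * y)⁺ˢ)⁺ˢ := by
  rw [← plus_mul, ← plus_mul, ← mul_assoc,
    ← mul_assoc, he.plus_mul_cancel]

theorem plus_plus_mul_distrib (he : IsProj e) (x y : S) :
    ((e * x)⁺ˢ * y)⁺ˢ = ((e * x)⁺ˢ * (e * y)⁺ˢ)⁺ˢ := by
  rw [← plus_mul _ (e * y), ← mul_assoc, he.plus_mul_mul]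

theorem ast_ast_plus_mul (hf : IsProj f) (x y : S) :
    ((x * (f * y)⁺ˢ)∗ˢ * y)∗ˢ = ((x * f)∗ˢ * y)∗ˢ := by
  rw [← ast_mul, ← ast_mul, mul_assoc, mul_assoc,
    hf.plus_mul_cancel]

theorem plus_mul_ast_of_mul_plus_eq (he : IsProj e) (hf : IsProj f) (hg : IsProj g)
    (h : g * (e * f)⁺ˢ = g) : (e * (g * f)∗ˢ)⁺ˢ = g := by
  have hgf : g * (e * f) = g * f := by
    rw [← h, mul_assoc, mul_assoc, plus_mul_self, he.plus_mul_cancel]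
  have hample : e * (g * f)∗ˢ = g * f := by
    have := ample_ast (e * f) g
    rwa [h, hg.ast_eq, hgf, mul_assoc, hf.mul_ast_mul] at this
  rw [hample, ← hgf, plus_mul, h, hg]

theorem plus_ast_mul_mul (he : IsProj e) (x y : S) :
    ((e * x)∗ˢ * y)⁺ˢ = ((e * (x * y)⁺ˢ)⁺ˢ * x)∗ˢ := by
  have hample : (e * x * y)⁺ˢ * x = e * x * ((e * x)∗ˢ * y)⁺ˢ := by
    have := ample_plus (e * x) y
    rwa [← mul_assoc, mul_assoc e, he.plus_mul_mul, ← mul_assoc] at this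
  rw [← plus_mul, ← mul_assoc, hample, ast_mul (e * x), (isProj_ast _).mul_plus_mul, plus_ast]

end IsProj

/-- The natural partial order of a DRC-restriction semigroup. -/
def NatLe (x y : S) : Prop := x = x⁺ˢ * y ∧ y⁺ˢ * x⁺ˢ * y⁺ˢ = x⁺ˢ

theorem natLe_iff (x y : S) :
    NatLe x y ↔ x = x⁺ˢ * y ∧ y⁺ˢ * x⁺ˢ = x⁺ˢ ∧ x⁺ˢ * y⁺ˢ = x⁺ˢ := by
  refine and_congr_right fun _ => ⟨fun h => ⟨?_, ?_⟩, fun h => by rw [h.1, h.2]⟩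
  · rw [← h, ← mul_assoc, ← mul_assoc, plus_idem]
  · rw [← h, mul_assoc, plus_idem]

namespace NatLe

variable {x y z : S}

theorem op (h : NatLe x y) : NatLe (op x) (op y) := by
  obtain ⟨hx, -, hp⟩ := (natLe_iff x y).1 h
  have hample : x = y * x∗ˢ := by
    have := ample_ast y x⁺ˢ
    rwa [hp, ← hx, plus_ast, ← hx, eq_comm] at this
  have hyx : MulOpposite.op y * MulOpposite.op x⁺ˢ = MulOpposite.op x :=
    congrArg MulOpposite.op hx.symm
  refine (natLe_iff _ _).2 ⟨congrArg MulOpposite.op hample, ?_, ?_⟩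
  · simpa only [hyx] using plus_mul_plus_mul (MulOpposite.op y) (MulOpposite.op x⁺ˢ)
  · simpa only [hyx] using plus_mul_mul_plus (MulOpposite.op y) (MulOpposite.op x⁺ˢ)

theorem unop (h : NatLe (MulOpposite.op x) (MulOpposite.op y)) : NatLe x y :=
  have h' := h.op
  ⟨congrArg (fun z => z.unop.unop) h'.1, congrArg (fun z => z.unop.unop) h'.2⟩

theorem refl (x : S) : NatLe x x :=
  (natLe_iff x x).2 ⟨(plus_mul_self x).symm, plus_idem x, plus_idem x⟩

theorem trans (h : NatLe x y) (h' : NatLe y z) : NatLe x z := by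
  obtain ⟨hx, hyx, hxy⟩ := (natLe_iff x y).1 h
  obtain ⟨hy, hzy, hyz⟩ := (natLe_iff y z).1 h'
  refine (natLe_iff x z).2 ⟨?_, ?_, ?_⟩
  · rw [← hxy, mul_assoc, ← hy, ← hx]
  · rw [← hyx, ← mul_assoc, hzy]
  · rw [← hxy, mul_assoc, hyz]

theorem antisymm (h : NatLe x y) (h' : NatLe y x) : x = y := by
  have hplus : x⁺ˢ = y⁺ˢ := by rw [← ((natLe_iff x y).1 h).2.2, ((natLe_iff y x).1 h').2.1]
  rw [h.1, hplus, plus_mul_self]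

theorem plus (h : NatLe x y) : NatLe x⁺ˢ y⁺ˢ := by
  obtain ⟨-, hyx, hxy⟩ := (natLe_iff x y).1 h
  rw [natLe_iff, plus_plus, plus_plus]
  exact ⟨hxy.symm, hyx, hxy⟩

theorem ast (h : NatLe x y) : NatLe x∗ˢ y∗ˢ := h.op.plus.unop

theorem mul {a b c e : S} (h : a∗ˢ = c⁺ˢ) (h' : b∗ˢ = e⁺ˢ) (hab : NatLe a b) (hce : NatLe c e) :
    NatLe (a * c) (b * e) := by
  rw [NatLe, plus_mul_of_ast_eq h, plus_mul_of_ast_eq h']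
  refine ⟨?_, hab.2⟩
  calc a * c = a * a∗ˢ * e := by rw [mul_assoc, h, ← hce.1]
    _ = a⁺ˢ * (b * e) := by rw [mul_ast_self, ← mul_assoc, ← hab.1]

end NatLe

theorem natLe_iff_ast (x y : S) :
    NatLe x y ↔ x = y * x∗ˢ ∧ y∗ˢ * x∗ˢ = x∗ˢ ∧ x∗ˢ * y∗ˢ = x∗ˢ :=
  (⟨NatLe.op, NatLe.unop⟩ : NatLe x y ↔ NatLe (op x) (op y)).trans <| (natLe_iff _ _).trans
    ⟨fun h => ⟨congrArg unop h.1, congrArg unop h.2.2, congrArg unop h.2.1⟩,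
      fun h => ⟨congrArg op h.1, congrArg op h.2.2, congrArg op h.2.1⟩⟩

theorem IsProj.natLe_iff {e f : S} (he : IsProj e) (hf : IsProj f) :
    NatLe e f ↔ e = (f * e)⁺ˢ := by
  rw [ChainPO.natLe_iff, he, hf]
  refine ⟨fun ⟨_, hfe, _⟩ => by rw [hfe, he], fun h => ?_⟩
  have hef : e * f = e := by simpa only [← h] using hf.plus_mul_mul e
  exact ⟨hef.symm, by simpa only [← h] using hf.mul_plus_mul e, hef⟩

theorem IsProj.existsUnique_natLe_plus_eq {p a : S} (hp : IsProj p) (h : NatLe p a⁺ˢ) :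
    ∃! x, NatLe x a ∧ x⁺ˢ = p := by
  rw [ChainPO.natLe_iff, hp, plus_plus] at h
  have hplus : (p * a)⁺ˢ = p := by rw [plus_mul, h.2.2, hp]
  refine ⟨p * a, ⟨(ChainPO.natLe_iff _ _).2 ?_, hplus⟩, fun x hx => hx.2 ▸ hx.1.1⟩
  rw [hplus]
  exact ⟨rfl, h.2⟩

theorem IsProj.existsUnique_natLe_ast_eq {q a : S} (hq : IsProj q) (h : NatLe q a∗ˢ) :
    ∃! x, NatLe x a ∧ x∗ˢ = q := by
  obtain ⟨x, ⟨hx, hxq⟩, hunique⟩ := hq.op.existsUnique_natLe_plus_eq h.op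
  exact ⟨x.unop, ⟨hx.unop, congrArg MulOpposite.unop hxq⟩, fun y hy =>
    congrArg MulOpposite.unop (hunique (MulOpposite.op y)
      ⟨hy.1.op, congrArg MulOpposite.op hy.2⟩)⟩

/-! ### The projection ordered category of a DRC-restriction semigroup -/

variable (S) in
/-- The category of a DRC-restriction semigroup: the arrows are the elements, and composition is
the restricted product. -/
@[reducible]
def semigroupArrowCat : ArrowCat S where
  d x := x⁺ˢ
  r x := x∗ˢ
  comp x y _ := x * y
  d_comp _ _ h := plus_mul_of_ast_eq h
  r_comp _ _ h := ast_mul_of_ast_eq h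
  assoc a b c _ _ := mul_assoc a b c
  r_d := plus_ast
  d_r x := (ast_plus x).symm
  d_comp_self := plus_mul_self
  comp_r_self := mul_ast_self

attribute [local instance] semigroupArrowCat

theorem isProj_obj (p : Obj S) : IsProj p.1 := by
  obtain ⟨_, a, rfl⟩ := p
  exact isProj_plus a

variable (S) in
/-- The category of a DRC-restriction semigroup, ordered by the natural partial order. -/
@[reducible]
def semigroupOrderedCat : OrderedCat S where
  toArrowCat := semigroupArrowCat S
  le := NatLe
  le_refl := NatLe.refl
  le_trans _ _ _ := NatLe.trans
  le_antisymm _ _ := NatLe.antisymm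
  O1_d _ _ := NatLe.plus
  O1_r _ _ := NatLe.ast
  O2 _ _ _ _ := NatLe.mul
  O3 _ p h := (isProj_obj p).existsUnique_natLe_plus_eq h
  O4 _ q h := (isProj_obj q).existsUnique_natLe_ast_eq h

variable (S) in
/-- The projection algebra of a DRC-restriction semigroup: `e × f = (e f)⁺` and
`e ⋆ f = (e f)*`. -/
@[reducible]
def semigroupProjectionAlgebra : StrongProjectionAlgebra (Obj S) where
  times e f := ⟨(e.1 * f.1)⁺ˢ, _, rfl⟩
  star e f := ⟨(e.1 * f.1)∗ˢ, (e.1 * f.1)∗ˢ, ast_plus _⟩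
  L1 e := Subtype.ext ((congrArg _ (isProj_obj e).idem).trans (isProj_obj e))
  L2 e f := Subtype.ext ((congrArg _ ((isProj_obj e).plus_mul_mul f.1)).trans (plus_plus _))
  L3 e f g := Subtype.ext ((isProj_obj e).plus_mul_plus_left f.1 g.1)
  L4 e f g := Subtype.ext ((isProj_obj e).plus_plus_mul_distrib f.1 g.1)
  R1 e := Subtype.ext ((congrArg _ (isProj_obj e).idem).trans (isProj_obj e).ast_eq)
  R2 e f := Subtype.ext ((ast_ast _).symm.trans
    (congrArg _ ((isProj_obj e).mul_ast_mul f.1).symm))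
  R3 e f g := Subtype.ext (congrArg unop ((isProj_obj e).op.plus_mul_plus_left (op f.1) (op g.1)))
  R4 e f g := Subtype.ext (congrArg unop
    ((isProj_obj e).op.plus_plus_mul_distrib (op f.1) (op g.1)))
  P3_star e f g := Subtype.ext ((isProj_obj f).ast_ast_plus_mul e.1 g.1)
  P3_times e f g := Subtype.ext (congrArg unop
    ((isProj_obj f).op.ast_ast_plus_mul (op e.1) (op g.1)))
  P4_times e f := Subtype.ext ((congrArg _ ((isProj_obj e).plus_mul_mul f.1)).trans (plus_ast _))
  P4_star e f := Subtype.ext ((congrArg _ ((isProj_obj f).mul_ast_mul e.1)).trans (ast_plus _))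
  SP1 e f g := Subtype.ext ((isProj_obj e).plus_mul_ast_of_mul_plus_eq (isProj_obj f)
    (isProj_plus _) ((isProj_plus _).plus_mul_mul g.1))
  SP2 e f g := Subtype.ext (congrArg unop ((isProj_obj e).op.plus_mul_ast_of_mul_plus_eq
    (isProj_obj f).op (isProj_ast _).op (congrArg op ((isProj_ast _).mul_ast_mul g.1))))

variable (S) in
/-- The weak projection ordered category of a DRC-restriction semigroup. -/
@[reducible]
def semigroupWeakProjectionOrderedCat : WeakProjectionOrderedCat S where
  toOrderedCat := semigroupOrderedCat S
  alg := semigroupProjectionAlgebra S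
  le_iff p q := ((isProj_obj p).natLe_iff (isProj_obj q)).trans
    ⟨fun h => Subtype.ext h, fun h => congrArg Subtype.val h⟩

end DRC

/-! ### Restrictions in ordered categories -/

section Ordered

variable {C : Type u} [OrderedCat C]

theorem eq_lres {p : Obj C} {a x : C} (h : p.1 ≤ d a) (hx : x ≤ a) (hd : d x = p.1) :
    x = lres p a h :=
  (OrderedCat.O3 a p h).unique ⟨hx, hd⟩ ⟨lres_le p a h, d_lres p a h⟩

theorem eq_rres {a x : C} {q : Obj C} (h : q.1 ≤ r a) (hx : x ≤ a) (hr : r x = q.1) :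
    x = rres a q h :=
  (OrderedCat.O4 a q h).unique ⟨hx, hr⟩ ⟨rres_le a q h, r_rres a q h⟩

theorem eq_of_le_of_d_eq {a x y : C} (hx : x ≤ a) (hy : y ≤ a) (h : d x = d y) : x = y :=
  (OrderedCat.O3 a (dObj y) (OrderedCat.O1_d _ _ hy)).unique ⟨hx, h⟩ ⟨hy, rfl⟩

theorem eq_of_le_of_r_eq {a x y : C} (hx : x ≤ a) (hy : y ≤ a) (h : r x = r y) : x = y :=
  (OrderedCat.O4 a (rObj y) (OrderedCat.O1_r _ _ hy)).unique ⟨hx, h⟩ ⟨hy, rfl⟩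

end Ordered

/-! ### The chain projection ordered category of a DRC-restriction semigroup -/

section DRC

variable {S : Type u} [DRCRestrictionSemigroup S]

open DRCRestrictionSemigroup

section

attribute [local instance] semigroupWeakProjectionOrderedCat

theorem semigroup_lres (p : Obj S) (a : S) (h : p.1 ≤ d a) : lres p a h = p.1 * a :=
  (lres_le p a h).1.trans (congrArg (· * a) (d_lres p a h))

theorem semigroup_rres (a : S) (q : Obj S) (h : q.1 ≤ r a) : rres a q h = a * q.1 :=
  ((natLe_iff_ast _ _).1 (rres_le a q h)).1.trans (congrArg (a * ·) (r_rres a q h))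

theorem semigroup_Theta (a : S) (x : Obj S) : (Theta a x).1 = (x.1 * a)∗ˢ :=
  calc (Theta a x).1 = ((x.1 * a⁺ˢ)∗ˢ * a)∗ˢ := congrArg (·∗ˢ) (semigroup_lres _ _ _)
    _ = (x.1 * a)∗ˢ := by rw [← ast_mul, mul_assoc, plus_mul_self]

theorem semigroup_Delta (a : S) (y : Obj S) : (Delta a y).1 = (a * y.1)⁺ˢ :=
  calc (Delta a y).1 = (a * (a∗ˢ * y.1)⁺ˢ)⁺ˢ := congrArg (·⁺ˢ) (semigroup_rres _ _ _)
    _ = (a * y.1)⁺ˢ := by rw [← plus_mul, ← mul_assoc, mul_ast_self]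

theorem semigroup_Theta_times (a : S) (p t : Obj S) :
    Theta a p ×ₚ t = Theta a (p ×ₚ Delta a t) := Subtype.ext <|
  calc ((Theta a p).1 * t.1)⁺ˢ = ((p.1 * a)∗ˢ * t.1)⁺ˢ := by rw [semigroup_Theta]
    _ = ((p.1 * (a * t.1)⁺ˢ)⁺ˢ * a)∗ˢ := (isProj_obj p).plus_ast_mul_mul a t.1
    _ = ((p.1 * (Delta a t).1)⁺ˢ * a)∗ˢ := by rw [semigroup_Delta]
    _ = (Theta a (p ×ₚ Delta a t)).1 := (semigroup_Theta a (p ×ₚ Delta a t)).symm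

theorem semigroup_star_Delta (a : S) (p t : Obj S) :
    t ⋆ₚ Delta a p = Delta a (Theta a t ⋆ₚ p) := Subtype.ext <|
  calc (t.1 * (Delta a p).1)∗ˢ = (t.1 * (a * p.1)⁺ˢ)∗ˢ := by rw [semigroup_Delta]
    _ = (a * ((t.1 * a)∗ˢ * p.1)∗ˢ)⁺ˢ :=
      congrArg unop ((isProj_obj p).op.plus_ast_mul_mul (op a) (op t.1))
    _ = (a * ((Theta a t).1 * p.1)∗ˢ)⁺ˢ := by rw [semigroup_Theta]
    _ = (Delta a (Theta a t ⋆ₚ p)).1 := (semigroup_Delta a (Theta a t ⋆ₚ p)).symm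

variable (S) in
/-- The projection ordered category of a DRC-restriction semigroup. -/
@[reducible]
noncomputable def semigroupProjectionOrderedCat : ProjectionOrderedCat S where
  toWeakProjectionOrderedCat := semigroupWeakProjectionOrderedCat S
  G1_delta := semigroup_Theta_times
  G1_theta := semigroup_star_Delta

end

attribute [local instance] semigroupProjectionOrderedCat

/-- The product `q q₁ ⋯ q_k` of a nonempty list `q, q₁, …, q_k` of projections. -/
noncomputable def projProd (q : Obj S) (l : List (Obj S)) : S := l.foldl (fun x p => x * p.1) q.1

theorem foldl_mul_left (l : List (Obj S)) (x y : S) :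
    l.foldl (fun x p => x * p.1) (x * y) = x * l.foldl (fun x p => x * p.1) y := by
  induction l generalizing y with
  | nil => rfl
  | cons s l ih => rw [List.foldl_cons, List.foldl_cons, mul_assoc, ih]

theorem projProd_cons (q s : Obj S) (l : List (Obj S)) :
    projProd q (s :: l) = q.1 * projProd s l := foldl_mul_left l q.1 s.1

theorem mul_projProd_self (q : Obj S) (l : List (Obj S)) : q.1 * projProd q l = projProd q l := by
  rw [← projProd_cons, projProd, List.foldl_cons, (isProj_obj q).idem, projProd]

theorem plus_projProd {q : Obj S} {l : List (Obj S)} (hl : (q :: l).IsChain PF) :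
    (projProd q l)⁺ˢ = q.1 := by
  induction l generalizing q with
  | nil => exact isProj_obj q
  | cons s l ih =>
    obtain ⟨hqs, hl⟩ := List.isChain_cons_cons.1 hl
    rw [projProd_cons, plus_mul, ih hl]
    exact (congrArg Subtype.val hqs.1).symm

theorem ast_projProd {q : Obj S} {l : List (Obj S)} (hl : (q :: l).IsChain PF) :
    (projProd q l)∗ˢ = ((q :: l).getLast (List.cons_ne_nil q l)).1 := by
  induction l generalizing q with
  | nil => exact (isProj_obj q).ast_eq
  | cons s l ih =>
    obtain ⟨hqs, hl⟩ := List.isChain_cons_cons.1 hl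
    have hqs : (q.1 * s.1)∗ˢ = s.1 := (congrArg Subtype.val hqs.2).symm
    rw [projProd_cons, ← mul_projProd_self, ← mul_assoc, ast_mul, hqs, mul_projProd_self, ih hl,
      List.getLast_cons_cons]

/-- The left-hand side is the product of the restriction `_r⇃(q, …)`. -/
theorem projProd_scanl {r q : Obj S} (h : r.1 * q.1 = r.1) (l : List (Obj S)) :
    projProd r (l.scanl (· ⋆ₚ ·) r).tail = r.1 * projProd q l := by
  induction l generalizing r q with
  | nil => exact h.symm
  | cons t l ih =>
    have ht := isProj_obj t
    have hrt : (r ⋆ₚ t).1 = (r.1 * t.1)∗ˢ := rfl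
    have hscanl : l.scanl (· ⋆ₚ ·) (r ⋆ₚ t) = (r ⋆ₚ t) :: (l.scanl (· ⋆ₚ ·) (r ⋆ₚ t)).tail := by
      cases l <;> simp
    rw [List.scanl_cons, List.tail_cons, hscanl, projProd_cons,
      ih (q := t) (by rw [hrt, ht.ast_mul_mul]), projProd_cons, ← mul_assoc, ← mul_assoc, h, hrt,
      ht.mul_ast_cancel, mul_assoc, mul_projProd_self]

/-- The product of the vertices of a path. -/
noncomputable def pathProd (p : PPath (Obj S)) : S := projProd p.dom p.verts.tail

theorem plus_pathProd (p : PPath (Obj S)) : (pathProd p)⁺ˢ = p.dom.1 := by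
  obtain ⟨_ | ⟨q, l⟩, hne, hl⟩ := p
  · exact absurd rfl hne
  · exact plus_projProd hl

theorem ast_pathProd (p : PPath (Obj S)) : (pathProd p)∗ˢ = p.cod.1 := by
  obtain ⟨_ | ⟨q, l⟩, hne, hl⟩ := p
  · exact absurd rfl hne
  · exact ast_projProd hl

theorem pathProd_comp (p q : PPath (Obj S)) (h : p.cod = q.dom) :
    pathProd (p.comp q h) = pathProd p * pathProd q := by
  have hp : pathProd p * q.dom.1 = pathProd p := by rw [← h, ← ast_pathProd, mul_ast_self]
  obtain ⟨_ | ⟨s, l⟩, hne, hl⟩ := p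
  · exact absurd rfl hne
  · refine List.foldl_append.trans ?_
    refine Eq.trans ?_ (foldl_mul_left q.verts.tail _ q.dom.1)
    rw [hp]
    rfl

theorem PPath.dom_eq_of_verts_eq_scanl {P : Type u} [ProjectionAlgebra P] {p : PPath P}
    {l : List P} {s : P} (h : p.verts = l.scanl (· ⋆ₚ ·) s) : p.dom = s := by
  obtain ⟨v, hv, hc⟩ := p
  subst h
  cases l <;> simp [PPath.dom]

theorem pathProd_le {p q : PPath (Obj S)} (h : p.Le q) : pathProd p ≤ pathProd q := by
  obtain ⟨s, hs, hp⟩ := h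
  have hdom : p.dom = s := PPath.dom_eq_of_verts_eq_scanl hp
  have hsq : NatLe s.1 q.dom.1 := (WeakProjectionOrderedCat.le_iff s q.dom).2 hs
  have hs' := (natLe_iff _ _).1 hsq
  rw [isProj_obj s, isProj_obj q.dom] at hs'
  refine (natLe_iff _ _).2 ?_
  rw [plus_pathProd, plus_pathProd, hdom]
  refine ⟨?_, hs'.2⟩
  rw [pathProd, hdom, hp, projProd_scanl hs'.2.2, pathProd]

variable (S) in
/-- The evaluation map of a DRC-restriction semigroup: `ε(p₁, …, p_k) = p₁ ⋯ p_k`. -/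
noncomputable def semigroupEvaluation : EvaluationMap S where
  toFun := pathProd
  E1_single _ := rfl
  E1_pair p := (isProj_obj p).idem
  E2_d := plus_pathProd
  E2_r := ast_pathProd
  E3 := pathProd_comp
  E4 _ _ := pathProd_le

theorem semigroup_lam (b : S) (e f : Obj S) (h : IsLinkedPair b e f) :
    lam (semigroupEvaluation S) b e f h = e.1 * b * f.1 := by
  have hb := isProj_plus b
  calc lam (semigroupEvaluation S) b e f h
      = e.1 * (e.1 * b⁺ˢ)∗ˢ * ((e.1 * b⁺ˢ)∗ˢ * b) * ((Theta b e).1 * f.1) :=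
        congrArg (e.1 * (e.1 * b⁺ˢ)∗ˢ * · * ((Theta b e).1 * f.1)) (semigroup_lres _ _ _)
    _ = e.1 * b * ((Theta b e).1 * f.1) := by
        rw [hb.mul_ast_cancel, ← mul_assoc (e.1 * b⁺ˢ), mul_assoc e.1 b⁺ˢ _, hb.mul_ast_mul,
          hb.mul_ast_cancel, mul_assoc e.1, plus_mul_self]
    _ = e.1 * b * f.1 := by rw [semigroup_Theta, ← mul_assoc, mul_ast_self]

theorem semigroup_rho (b : S) (e f : Obj S) (h : IsLinkedPair b e f) :
    rho (semigroupEvaluation S) b e f h = e.1 * b * f.1 := by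
  have hb := isProj_ast b
  calc rho (semigroupEvaluation S) b e f h
      = e.1 * (Delta b f).1 * (b * (b∗ˢ * f.1)⁺ˢ) * ((b∗ˢ * f.1)⁺ˢ * f.1) :=
        congrArg (e.1 * (Delta b f).1 * · * ((b∗ˢ * f.1)⁺ˢ * f.1)) (semigroup_rres _ _ _)
    _ = e.1 * (Delta b f).1 * (b * f.1) := by
        rw [hb.plus_mul_cancel, mul_assoc _ (b * _), mul_assoc b, plus_mul_self, ← mul_assoc b,
          mul_ast_self]
    _ = e.1 * b * f.1 := by rw [semigroup_Delta, mul_assoc, plus_mul_self, mul_assoc]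

variable (S) in
/-- The chain projection ordered category of a DRC-restriction semigroup. -/
@[reducible]
noncomputable def semigroupChainCat : ChainProjectionOrderedCat S where
  toProjectionOrderedCat := semigroupProjectionOrderedCat S
  ε := semigroupEvaluation S
  G2 b e f h := (semigroup_lam b e f h).trans (semigroup_rho b e f h).symm

end DRC

/-! ### Identities in projection algebras -/

section Algebra

variable {P : Type u} [ProjectionAlgebra P] {w D : P}

open ProjectionAlgebra

theorem PLe.trans {e f g : P} (hef : PLe e f) (hfg : PLe f g) : PLe e g := by
  have hL3 := L3 g f e
  rw [← show f = g ×ₚ f from hfg, ← show e = f ×ₚ e from hef] at hL3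
  exact Eq.trans hef hL3.symm

theorem PLe.star_star (h : PLe w D) (y : P) : w ⋆ₚ (D ⋆ₚ y) = w ⋆ₚ y := by
  simpa only [h.star_eq] using (R3 y D w).symm

theorem PLe.times_times (h : PLe w D) (y : P) : (y ×ₚ D) ×ₚ w = y ×ₚ w := by
  simpa only [← show w = D ×ₚ w from h] using (L3 y D w).symm

theorem PLe.star_left (h : PLe w D) (y : P) : PLe (w ⋆ₚ y) (D ⋆ₚ y) :=
  h.star_star y ▸ star_ple w (D ⋆ₚ y)

theorem PLe.times_right (h : PLe w D) (y : P) : PLe (y ×ₚ w) (y ×ₚ D) :=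
  h.times_times y ▸ times_ple (y ×ₚ D) w

end Algebra

theorem times_star_of_ple {P : Type u} [StrongProjectionAlgebra P] {D f y : P}
    (h : PLe f (D ⋆ₚ y)) : (D ×ₚ f) ⋆ₚ y = f := by
  simpa only [h.star_eq] using StrongProjectionAlgebra.SP2 y D f

/-! ### Composites and restrictions -/

section Arrows

variable {C : Type u} [ArrowCat C]

theorem comp_congr {a a' b b' : C} (h : r a = d b) (h' : r a' = d b') (ha : a = a')
    (hb : b = b') : comp a b h = comp a' b' h' := by
  subst ha hb
  rfl

theorem comp_assoc_left {u x b y w : C} (h₁ : r u = d x) (h₂ : r x = d b) (h₃ : r b = d y)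
    (h₄ : r y = d w) :
    comp (comp (comp (comp u x h₁) b ((r_comp _ _ _).trans h₂)) y ((r_comp _ _ _).trans h₃)) w
        ((r_comp _ _ _).trans h₄) =
      comp (comp u (comp (comp x b h₂) y ((r_comp _ _ _).trans h₃))
        (h₁.trans (((d_comp _ _ _).trans (d_comp _ _ _)).symm))) w
        ((r_comp _ _ _).trans ((r_comp _ _ _).trans h₄)) := by
  refine comp_congr _ _ ?_ rfl
  rw [← assoc u (comp x b h₂) y (h₁.trans (d_comp _ _ _).symm)]
  exact comp_congr _ _ (assoc _ _ _ _ _) rfl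

theorem comp_assoc_right {u x b y w : C} (h₁ : r u = d x) (h₂ : r x = d b) (h₃ : r b = d y)
    (h₄ : r y = d w) :
    comp (comp u x h₁) (comp (comp b y h₃) w ((r_comp _ _ _).trans h₄))
        ((r_comp _ _ _).trans (h₂.trans ((d_comp _ _ _).trans (d_comp _ _ _)).symm)) =
      comp (comp u (comp (comp x b h₂) y ((r_comp _ _ _).trans h₃))
        (h₁.trans (((d_comp _ _ _).trans (d_comp _ _ _)).symm))) w
        ((r_comp _ _ _).trans ((r_comp _ _ _).trans h₄)) := by
  rw [← comp_assoc_left h₁ h₂ h₃ h₄, ← assoc (comp u x h₁) (comp b y h₃) w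
    ((r_comp _ _ _).trans (h₂.trans (d_comp _ _ _).symm))]
  exact comp_congr _ _ (assoc _ _ _ _ _).symm rfl

theorem r_obj (p : Obj C) : r p.1 = p.1 := by
  obtain ⟨_, a, rfl⟩ := p
  exact r_d a

theorem dObj_obj (p : Obj C) : dObj p.1 = p := Subtype.ext (d_obj p)

theorem rObj_obj (p : Obj C) : rObj p.1 = p := Subtype.ext (r_obj p)

theorem comp_of_left_eq {a x : C} {p : Obj C} (h : r x = d a) (hx : x = p.1) :
    comp x a h = a :=
  (comp_congr h (r_d a) (by rw [← h, hx, r_obj]) rfl).trans (d_comp_self a)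

theorem comp_of_right_eq {a x : C} {p : Obj C} (h : r a = d x) (hx : x = p.1) :
    comp a x h = a :=
  (comp_congr h (d_r a) rfl (by rw [h, hx, d_obj])).trans (comp_r_self a)

end Arrows

section Ordered

variable {C : Type u} [OrderedCat C]

theorem lres_mono {p q : Obj C} {a : C} (hp : p.1 ≤ d a) (hq : q.1 ≤ d a) (h : p.1 ≤ q.1) :
    lres p a hp ≤ lres q a hq := by
  have hpq : p.1 ≤ d (lres q a hq) := h.trans_eq (d_lres q a hq).symm
  rw [← eq_lres hp ((lres_le p _ hpq).trans (lres_le q a hq)) (d_lres p _ hpq)]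
  exact lres_le p _ hpq

theorem rres_mono {p q : Obj C} {a : C} (hp : p.1 ≤ r a) (hq : q.1 ≤ r a) (h : p.1 ≤ q.1) :
    rres a p hp ≤ rres a q hq := by
  have hpq : p.1 ≤ r (rres a q hq) := h.trans_eq (r_rres a q hq).symm
  rw [← eq_rres hp ((rres_le _ p hpq).trans (rres_le a q hq)) (r_rres _ p hpq)]
  exact rres_le _ p hpq

end Ordered

/-! ### Associativity of the product of a chain projection ordered category -/

section Chain

variable {C : Type u} [ChainProjectionOrderedCat C]

open ChainProjectionOrderedCat ProjectionAlgebra ProjectionOrderedCat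

/-- The arrow `u ∘ ε(p, q) ∘ v`, for `u` with target `p` and `v` with source `q`. The product
`a • b` is of this form, with `u` and `v` restrictions of `a` and `b`. -/
def bridge (u v : C) (p q : Obj C) (h : PF p q) (hu : r u = p.1) (hv : d v = q.1) : C :=
  comp (comp u (ε.two p q h) (hu.trans (EvaluationMap.d_two _ _ _ _).symm)) v
    ((r_comp _ _ _).trans ((EvaluationMap.r_two _ _ _ _).trans hv.symm))

theorem d_bridge (u v : C) (p q : Obj C) (h hu hv) : d (bridge u v p q h hu hv) = d u :=
  (d_comp _ _ _).trans (d_comp _ _ _)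

theorem r_bridge (u v : C) (p q : Obj C) (h hu hv) : r (bridge u v p q h hu hv) = r v :=
  r_comp _ _ _

theorem bridge_le_bridge {u u' v v' : C} {p p' q q' : Obj C} {h : PF p q} {hu : r u = p.1}
    {hv : d v = q.1} {h' : PF p' q'} {hu' : r u' = p'.1} {hv' : d v' = q'.1} (hle : u ≤ u')
    (hε : (ε.two p q h : C) ≤ ε.two p' q' h') (hle' : v ≤ v') :
    bridge u v p q h hu hv ≤ bridge u' v' p' q' h' hu' hv' :=
  OrderedCat.O2 _ _ _ _ _ _ (OrderedCat.O2 _ _ _ _ _ _ hle hε) hle'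

theorem bridge_self (u v : C) (p : Obj C) (hu : r u = p.1) (hv : d v = p.1) :
    bridge u v p p (PF_refl p) hu hv = comp u v (hu.trans hv.symm) :=
  comp_congr _ _ (comp_of_right_eq _ (ε.E1_pair p)) rfl

theorem bullet_eq_bridge {a b u v : C} (hu : u ≤ a) (hv : v ≤ b) {p q : Obj C} (h : PF p q)
    (hp : p = rObj a ×ₚ dObj b) (hq : q = rObj a ⋆ₚ dObj b) (hru : r u = p.1) (hdv : d v = q.1) :
    bullet a b = bridge u v p q h hru hdv := by
  subst hp hq
  exact comp_congr _ _ (comp_congr _ _ (eq_rres _ hu hru).symm rfl) (eq_lres _ hv hdv).symm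

theorem dObj_bullet (a b : C) : dObj (bullet a b) = Delta a (dObj b) :=
  Subtype.ext (d_bridge _ _ _ _ (PF_times_star _ _) (r_rres _ _ _) (d_lres _ _ _))

theorem rObj_bullet (a b : C) : rObj (bullet a b) = Theta b (rObj a) :=
  Subtype.ext (r_bridge _ _ _ _ (PF_times_star _ _) (r_rres _ _ _) (d_lres _ _ _))

theorem d_lam (b : C) (e f : Obj C) (h) : d (lam ε b e f h) = e.1 :=
  (d_comp _ _ _).trans ((d_comp _ _ _).trans (EvaluationMap.d_two _ _ _ _))

theorem r_lam (b : C) (e f : Obj C) (h) : r (lam ε b e f h) = f.1 :=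
  (r_comp _ _ _).trans (EvaluationMap.r_two _ _ _ _)

theorem d_rho (b : C) (e f : Obj C) (h) : d (rho ε b e f h) = e.1 :=
  (d_comp _ _ _).trans ((d_comp _ _ _).trans (EvaluationMap.d_two _ _ _ _))

theorem r_rho (b : C) (e f : Obj C) (h) : r (rho ε b e f h) = f.1 :=
  (r_comp _ _ _).trans (EvaluationMap.r_two _ _ _ _)

theorem isLinkedPair (b : C) (x y : Obj C) :
    IsLinkedPair b (x ×ₚ Delta b y) (Theta b x ⋆ₚ y) where
  right := by
    rw [← G1_delta]
    exact (PF_times_star _ _).2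
  left := by
    rw [← G1_theta]
    exact (PF_times_star _ _).1

theorem two_le_two {p q s t : Obj C} {h : PF p q} (hs : PLe s p) {hst : PF s t}
    (ht : t = s ⋆ₚ q) : (ε.two s t hst : C) ≤ ε.two p q h := by
  subst ht
  exact ε.E4 _ _ ⟨s, hs, rfl⟩

theorem bridge_lres_le_bullet {a b u : C} {e : Obj C} (he : PLe e (rObj a ×ₚ dObj b))
    (h : PF e (e ⋆ₚ dObj b)) (hua : u ≤ a) (hu : r u = e.1) :
    bridge u (lres (e ⋆ₚ dObj b) b (le_of_ple (star_ple _ _))) e (e ⋆ₚ dObj b) h hu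
      (d_lres _ _ _) ≤ bullet a b := by
  have hea : PLe e (rObj a) := he.trans (times_ple _ _)
  have hu_eq := eq_rres (le_of_ple hea) hua hu
  exact bridge_le_bridge (hu' := r_rres _ _ _) (hv' := d_lres _ _ _)
    (hu_eq ▸ rres_mono _ _ (le_of_ple he))
    (two_le_two he (hea.star_star _).symm) (lres_mono _ _ (le_of_ple (hea.star_left _)))

theorem bridge_rres_le_bullet {b c w : C} {f : Obj C} (hf : PLe f (rObj b ⋆ₚ dObj c))
    (h : PF (rObj b ×ₚ f) f) (hwc : w ≤ c) (hw : d w = f.1) :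
    bridge (rres b (rObj b ×ₚ f) (le_of_ple (times_ple _ _))) w (rObj b ×ₚ f) f h
      (r_rres _ _ _) hw ≤ bullet b c := by
  have hfc : PLe f (dObj c) := hf.trans (star_ple _ _)
  have hw_eq := eq_lres (le_of_ple hfc) hwc hw
  have hstar : f = (rObj b ×ₚ f) ⋆ₚ (rObj b ⋆ₚ dObj c) := by
    rw [(times_ple _ _).star_star, times_star_of_ple hf]
  exact bridge_le_bridge (hu' := r_rres _ _ _) (hv' := d_lres _ _ _)
    (rres_mono _ _ (le_of_ple (hfc.times_right _)))
    (two_le_two (hfc.times_right _) hstar) (hw_eq ▸ lres_mono _ _ (le_of_ple hf))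

theorem bullet_bullet_eq_lam {a b c u w : C} {e f : Obj C} (h : IsLinkedPair b e f)
    (he : e = rObj a ×ₚ Delta b (dObj c)) (hf : f = Theta b (rObj a) ⋆ₚ dObj c)
    (hua : u ≤ a) (hwc : w ≤ c) (hu : r u = e.1) (hw : d w = f.1) :
    bullet (bullet a b) c = comp (comp u (lam ε b e f h) (hu.trans (d_lam b e f h).symm)) w
      ((r_comp _ _ _).trans ((r_lam b e f h).trans hw.symm)) := by
  have hΘ : Theta b e = Theta b (rObj a) ×ₚ dObj c := by rw [he, G1_delta]
  have hle := bridge_lres_le_bullet (he ▸ (Delta_ple b _).times_right _) h.PF_e₁ hua hu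
  rw [bullet_eq_bridge hle hwc h.PF_f₁ (by rw [rObj_bullet, hΘ]) (by rw [rObj_bullet, hf])
    (r_bridge _ _ _ _ _ _ _) hw]
  exact comp_assoc_left (hu.trans (EvaluationMap.d_two _ _ _ _).symm)
    ((EvaluationMap.r_two _ _ _ _).trans (d_lres _ _ _).symm)
    (EvaluationMap.d_two ε (Theta b e) f h.PF_f₁).symm
    ((EvaluationMap.r_two _ _ _ _).trans hw.symm)

theorem bullet_bullet_eq_rho {a b c u w : C} {e f : Obj C} (h : IsLinkedPair b e f)
    (he : e = rObj a ×ₚ Delta b (dObj c)) (hf : f = Theta b (rObj a) ⋆ₚ dObj c)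
    (hua : u ≤ a) (hwc : w ≤ c) (hu : r u = e.1) (hw : d w = f.1) :
    bullet a (bullet b c) = comp (comp u (rho ε b e f h) (hu.trans (d_rho b e f h).symm)) w
      ((r_comp _ _ _).trans ((r_rho b e f h).trans hw.symm)) := by
  have hΔ : Delta b f = rObj a ⋆ₚ Delta b (dObj c) := by rw [hf, G1_theta]
  have hle := bridge_rres_le_bullet (hf ▸ (Theta_ple b _).star_left _) h.PF_f₂ hwc hw
  rw [bullet_eq_bridge hua hle h.PF_e₂ (by rw [dObj_bullet, he]) (by rw [dObj_bullet, hΔ]) hu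
    (d_bridge _ _ _ _ _ _ _)]
  exact comp_assoc_right (hu.trans (EvaluationMap.d_two _ _ _ _).symm)
    (EvaluationMap.r_two _ _ _ _) ((r_rres _ _ _).trans (EvaluationMap.d_two _ _ _ _).symm)
    ((EvaluationMap.r_two _ _ _ _).trans hw.symm)

theorem bullet_assoc (a b c : C) : bullet (bullet a b) c = bullet a (bullet b c) := by
  have he : PLe (rObj a ×ₚ Delta b (dObj c)) (rObj a) := times_ple _ _
  have hf : PLe (Theta b (rObj a) ⋆ₚ dObj c) (dObj c) := star_ple _ _
  have h := isLinkedPair b (rObj a) (dObj c)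
  have hua := rres_le a _ (le_of_ple he)
  have hwc := lres_le _ c (le_of_ple hf)
  rw [bullet_bullet_eq_lam h rfl rfl hua hwc (r_rres _ _ _) (d_lres _ _ _),
    bullet_bullet_eq_rho h rfl rfl hua hwc (r_rres _ _ _) (d_lres _ _ _)]
  exact comp_congr _ _ (comp_congr _ _ rfl (G2 _ _ _ _)) rfl

/-! ### The DRC-restriction semigroup of a chain projection ordered category -/

theorem bullet_eq_comp {x y : C} (h : r x = d y) : bullet x y = comp x y h := by
  have hxy : rObj x = dObj y := Subtype.ext h
  exact (bullet_eq_bridge le_rfl le_rfl (PF_refl (rObj x)) (by rw [← hxy, L1])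
    (by rw [← hxy, R1]) rfl h.symm).trans (bridge_self x y (rObj x) rfl h.symm)

theorem obj_bullet_of_le {p : Obj C} {a : C} (h : p.1 ≤ d a) : bullet p.1 a = lres p a h := by
  have hp : PLe p (dObj a) := (WeakProjectionOrderedCat.le_iff p (dObj a)).1 h
  rw [bullet_eq_bridge (le_refl p.1) (lres_le p a h) (PF_refl p) (by rw [rObj_obj, hp.times_eq])
    (by rw [rObj_obj, hp.star_eq]) (r_obj p) (d_lres _ _ _), bridge_self, comp_of_left_eq _ rfl]

theorem bullet_obj_of_le {q : Obj C} {a : C} (h : q.1 ≤ r a) : bullet a q.1 = rres a q h := by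
  have hq : PLe q (rObj a) := (WeakProjectionOrderedCat.le_iff q (rObj a)).1 h
  rw [bullet_eq_bridge (rres_le a q h) (le_refl q.1) (PF_refl q) (by rw [dObj_obj]; exact hq)
    (by rw [dObj_obj, hq.star_eq']) (r_rres _ _ _) (d_obj q), bridge_self, comp_of_right_eq _ rfl]

theorem obj_bullet_obj_of_le {p q : Obj C} (h : p.1 ≤ q.1) : bullet p.1 q.1 = p.1 := by
  have hp : p.1 ≤ d q.1 := h.trans_eq (d_obj q).symm
  rw [obj_bullet_of_le hp, ← eq_lres hp h (d_obj p)]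

theorem obj_bullet_obj_of_ge {p q : Obj C} (h : p.1 ≤ q.1) : bullet q.1 p.1 = p.1 := by
  have hp : p.1 ≤ r q.1 := h.trans_eq (r_obj q).symm
  rw [bullet_obj_of_le hp, ← eq_rres hp h (r_obj p)]

theorem d_bullet_self (a : C) : bullet (d a) a = a :=
  (bullet_eq_comp (r_d a)).trans (d_comp_self a)

theorem bullet_r_self (a : C) : bullet a (r a) = a :=
  (bullet_eq_comp (d_r a)).trans (comp_r_self a)

theorem d_bullet (a b : C) : d (bullet a b) = (Delta a (dObj b)).1 :=
  congrArg Subtype.val (dObj_bullet a b)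

theorem r_bullet (a b : C) : r (bullet a b) = (Theta b (rObj a)).1 :=
  congrArg Subtype.val (rObj_bullet a b)

theorem Theta_obj (p x : Obj C) : Theta p.1 x = x ⋆ₚ p := by
  have hp := dObj_obj p
  have hle : (x ⋆ₚ dObj p.1).1 ≤ p.1 := hp.symm ▸ le_of_ple (star_ple x p)
  have hres := eq_of_le_of_d_eq (lres_le (x ⋆ₚ dObj p.1) p.1 (le_of_ple (star_ple _ _))) hle
    ((d_lres _ _ _).trans (d_obj _).symm)
  refine Subtype.ext ((congrArg r hres).trans ?_)
  rw [r_obj, hp]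

theorem Delta_obj (p y : Obj C) : Delta p.1 y = p ×ₚ y := by
  have hp := rObj_obj p
  have hle : (rObj p.1 ×ₚ y).1 ≤ p.1 := hp.symm ▸ le_of_ple (times_ple p y)
  have hres := eq_of_le_of_r_eq (rres_le p.1 (rObj p.1 ×ₚ y) (le_of_ple (times_ple _ _))) hle
    ((r_rres _ _ _).trans (r_obj _).symm)
  refine Subtype.ext ((congrArg d hres).trans ?_)
  rw [d_obj, hp]

theorem d_obj_bullet (p : Obj C) (b : C) : d (bullet p.1 b) = (p ×ₚ dObj b).1 := by
  rw [d_bullet, Delta_obj]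

theorem r_bullet_obj (a : C) (p : Obj C) : r (bullet a p.1) = (rObj a ⋆ₚ p).1 := by
  rw [r_bullet, Theta_obj]

theorem bullet_r_bullet (a b : C) : bullet b (r (bullet a b)) = bullet (r (bullet a (d b))) b := by
  have hr : r (bullet a (d b)) = (rObj a ⋆ₚ dObj b).1 := r_bullet_obj a (dObj b)
  rw [hr, r_bullet, bullet_obj_of_le (Theta_le _ _),
    obj_bullet_of_le (a := b) (le_of_ple (star_ple (rObj a) (dObj b)))]
  exact eq_of_le_of_r_eq (rres_le _ _ _) (lres_le _ _ _) (r_rres _ _ _)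

theorem d_bullet_bullet (a b : C) : bullet (d (bullet a b)) a = bullet a (d (bullet (r a) b)) := by
  have hd : d (bullet (r a) b) = (rObj a ×ₚ dObj b).1 := d_obj_bullet (rObj a) b
  rw [hd, d_bullet, obj_bullet_of_le (Delta_le _ _),
    bullet_obj_of_le (a := a) (le_of_ple (times_ple (rObj a) (dObj b)))]
  exact eq_of_le_of_d_eq (lres_le _ _ _) (rres_le _ _ _) (d_lres _ _ _)

theorem d_bullet_d (a b : C) : d (bullet a (d b)) = d (bullet a b) :=
  (d_bullet a (dObj b).1).trans (by rw [dObj_obj, d_bullet])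

theorem r_r_bullet (a b : C) : r (bullet (r a) b) = r (bullet a b) :=
  (r_bullet (rObj a).1 b).trans (by rw [rObj_obj, r_bullet])

theorem obj_bullet_obj_bullet_obj_of_le {p q : Obj C} (h : p.1 ≤ q.1) :
    bullet (bullet q.1 p.1) q.1 = p.1 := by
  rw [obj_bullet_obj_of_ge h, obj_bullet_obj_of_le h]

theorem d_bullet_eq (a b : C) : d (bullet a b) = bullet (bullet (d a) (d (bullet a b))) (d a) :=
  (d_bullet a b).symm ▸ (obj_bullet_obj_bullet_obj_of_le (q := dObj a) (Delta_le _ _)).symm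

theorem r_bullet_eq (a b : C) : r (bullet a b) = bullet (bullet (r b) (r (bullet a b))) (r b) :=
  (r_bullet a b).symm ▸ (obj_bullet_obj_bullet_obj_of_le (q := rObj b) (Theta_le _ _)).symm

variable (C) in
/-- The DRC-restriction semigroup of a chain projection ordered category. -/
@[reducible]
noncomputable def chainSemigroup : DRCRestrictionSemigroup C where
  mul := bullet
  mul_assoc := bullet_assoc
  plus := d
  ast := r
  plus_mul_self := d_bullet_self
  mul_ast_self := bullet_r_self
  plus_mul x y := (d_bullet_d x y).symm
  ast_mul x y := (r_r_bullet x y).symm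
  plus_mul_eq := d_bullet_eq
  ast_mul_eq := r_bullet_eq
  plus_plus x := d_obj (dObj x)
  ast_ast x := r_obj (rObj x)
  plus_ast := r_d
  ast_plus x := (d_r x).symm
  ample_ast x y := bullet_r_bullet y x
  ample_plus x y := d_bullet_bullet x y

end Chain

/-! ### The two constructions are mutually inverse -/

theorem DRCRestrictionSemigroup.ext_of_eq {S : Type u} (s t : DRCRestrictionSemigroup S)
    (hm : ∀ x y : S, s.mul x y = t.mul x y) (hp : ∀ x : S, s.plus x = t.plus x)
    (ha : ∀ x : S, s.ast x = t.ast x) : s = t := by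
  rcases s with @⟨@⟨@⟨⟨ms⟩, _⟩, ps, as⟩⟩
  rcases t with @⟨@⟨@⟨⟨mt⟩, _⟩, pt, bt⟩⟩
  obtain rfl : ms = mt := funext fun x => funext (hm x)
  obtain rfl : ps = pt := funext hp
  obtain rfl : as = bt := funext ha
  rfl

theorem ArrowCat.ext_of_eq {C : Type u} (s t : ArrowCat C) (hd : ∀ x, s.d x = t.d x)
    (hr : ∀ x, s.r x = t.r x) (hc : ∀ x y h h', s.comp x y h = t.comp x y h') : s = t := by
  rcases s with ⟨ds, rs, cs⟩
  rcases t with ⟨dt, rt, ct⟩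
  obtain rfl : ds = dt := funext hd
  obtain rfl : rs = rt := funext hr
  obtain rfl : cs = ct := funext fun x => funext fun y => funext fun h => hc x y h h
  rfl

theorem StrongProjectionAlgebra.ext_of_eq {P : Type u} (s t : StrongProjectionAlgebra P)
    (ht : ∀ x y : P, s.times x y = t.times x y) (hs : ∀ x y : P, s.star x y = t.star x y) :
    s = t := by
  rcases s with @⟨@⟨ts, ss⟩⟩
  rcases t with @⟨@⟨tt, st⟩⟩
  obtain rfl : ts = tt := funext fun x => funext (ht x)
  obtain rfl : ss = st := funext fun x => funext (hs x)
  rfl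

theorem ChainProjectionOrderedCat.ext_of_eq {C : Type u} (s t : ChainProjectionOrderedCat C)
    (hd : ∀ x, s.d x = t.d x) (hr : ∀ x, s.r x = t.r x)
    (hc : ∀ x y h h', s.comp x y h = t.comp x y h') (hle : ∀ x y, s.le x y ↔ t.le x y)
    (ht : ∀ (e f : @Obj C s.toArrowCat) (e' f' : @Obj C t.toArrowCat), e.1 = e'.1 → f.1 = f'.1 →
      (s.alg.times e f).1 = (t.alg.times e' f').1)
    (hs : ∀ (e f : @Obj C s.toArrowCat) (e' f' : @Obj C t.toArrowCat), e.1 = e'.1 → f.1 = f'.1 →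
      (s.alg.star e f).1 = (t.alg.star e' f').1)
    (hε : ∀ (p : @PPath (@Obj C s.toArrowCat) s.alg.toProjectionAlgebra)
      (p' : @PPath (@Obj C t.toArrowCat) t.alg.toProjectionAlgebra),
      (@PPath.verts _ s.alg.toProjectionAlgebra p).map Subtype.val =
        (@PPath.verts _ t.alg.toProjectionAlgebra p').map Subtype.val →
      @EvaluationMap.toFun C s.toProjectionOrderedCat s.ε p =
        @EvaluationMap.toFun C t.toProjectionOrderedCat t.ε p') : s = t := by
  rcases s with @⟨@⟨@⟨@⟨as, os⟩, ps⟩⟩, es⟩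
  rcases t with @⟨@⟨@⟨@⟨bt, ot⟩, pt⟩⟩, et⟩
  obtain rfl : as = bt := ArrowCat.ext_of_eq _ _ hd hr hc
  obtain rfl : os = ot := PartialOrder.ext hle
  obtain rfl : ps = pt := StrongProjectionAlgebra.ext_of_eq _ _
    (fun x y => Subtype.ext (ht x y x y rfl rfl)) (fun x y => Subtype.ext (hs x y x y rfl rfl))
  obtain rfl : es = et := EvaluationMap.ext (funext fun p => hε p p rfl)
  rfl

section

variable {S T : Type u} [DRCRestrictionSemigroup S] [DRCRestrictionSemigroup T]

open DRCRestrictionSemigroup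

theorem IsProj.plus_mul_ast {e f : S} (he : IsProj e) (hf : IsProj f) :
    (e * f)⁺ˢ * (e * f)∗ˢ = e * f := by
  rw [← hf.mul_ast_mul e, ← mul_assoc, he.plus_mul_cancel, mul_ast_self]

section

attribute [local instance] semigroupChainCat

theorem semigroup_bullet (a b : S) : bullet a b = a * b := by
  calc bullet a b
      = a * (a∗ˢ * b⁺ˢ)⁺ˢ * ((a∗ˢ * b⁺ˢ)⁺ˢ * (a∗ˢ * b⁺ˢ)∗ˢ) * ((a∗ˢ * b⁺ˢ)∗ˢ * b) :=
        congrArg₂ (· * ((a∗ˢ * b⁺ˢ)⁺ˢ * (a∗ˢ * b⁺ˢ)∗ˢ) * ·)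
          (semigroup_rres _ _ _) (semigroup_lres _ _ _)
    _ = a * ((a∗ˢ * b⁺ˢ)⁺ˢ * (a∗ˢ * b⁺ˢ)∗ˢ) * b := by
        rw [mul_assoc a, ← mul_assoc (a∗ˢ * b⁺ˢ)⁺ˢ, plus_idem, ← mul_assoc, mul_assoc a,
          mul_assoc (a∗ˢ * b⁺ˢ)⁺ˢ, ast_idem]
    _ = a * (a∗ˢ * b⁺ˢ) * b := by rw [(isProj_ast a).plus_mul_ast (isProj_plus b)]
    _ = a * b := by rw [← mul_assoc, mul_ast_self, mul_assoc, plus_mul_self]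

end

theorem chainSemigroup_semigroupChainCat {S : Type u} (s : DRCRestrictionSemigroup S) :
    @chainSemigroup S (semigroupChainCat S) = s :=
  DRCRestrictionSemigroup.ext_of_eq _ _ semigroup_bullet (fun _ => rfl) (fun _ => rfl)

theorem BiunaryHom.map_natLe (φ : BiunaryHom S T) {x y : S} (h : NatLe x y) :
    NatLe (φ.toFun x) (φ.toFun y) := by
  rw [NatLe, ← φ.map_plus, ← φ.map_plus, ← φ.map_mul, ← φ.map_mul, ← φ.map_mul, ← h.1, h.2]
  exact ⟨rfl, rfl⟩

theorem BiunaryHom.map_foldl (φ : BiunaryHom S T) {ι : Type*} (g : ι → S) (l : List ι) (x : S) :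
    φ.toFun (l.foldl (fun x i => x * g i) x) =
      l.foldl (fun x i => x * φ.toFun (g i)) (φ.toFun x) := by
  induction l generalizing x with
  | nil => rfl
  | cons i l ih => rw [List.foldl_cons, List.foldl_cons, ih, φ.map_mul]

attribute [local instance] semigroupChainCat

theorem BiunaryHom.map_pathProd (φ : BiunaryHom S T) {p : PPath (Obj S)} {q : PPath (Obj T)}
    (h : q.verts = p.verts.map (objMap φ.toFun fun a => (φ.map_plus a).symm)) :
    φ.toFun (pathProd p) = pathProd q := by
  obtain ⟨_ | ⟨s, l⟩, hne, _⟩ := p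
  · exact absurd rfl hne
  · obtain ⟨_, _, _⟩ := q
    subst h
    refine (φ.map_foldl Subtype.val l s.1).trans ?_
    exact (List.foldl_map (f := objMap φ.toFun fun a => (φ.map_plus a).symm)
      (g := fun x q => x * q.1)).symm

/-- A (2,1,1)-homomorphism is a chain projection ordered functor. -/
noncomputable def BiunaryHom.toChainFunctor (φ : BiunaryHom S T) : ChainFunctor S T where
  toFun := φ.toFun
  F1_d a := (φ.map_plus a).symm
  F1_r a := (φ.map_ast a).symm
  F2 a b _ := φ.map_mul a b
  F3 _ _ := φ.map_natLe
  F4_times e f := Subtype.ext <| (φ.map_plus _).trans (congrArg (·⁺ˢ) (φ.map_mul e.1 f.1))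
  F4_star e f := Subtype.ext <| (φ.map_ast _).trans (congrArg (·∗ˢ) (φ.map_mul e.1 f.1))
  F5 _ := φ.map_pathProd rfl

end

section

variable {C D : Type u} [ChainProjectionOrderedCat C] [ChainProjectionOrderedCat D]

open ChainProjectionOrderedCat

theorem bullet_obj_of_PF {x : C} {p q : Obj C} (h : PF p q) (hx : r x = p.1) :
    bullet x q.1 = comp x (ε.two p q h) (hx.trans (EvaluationMap.d_two _ _ _ _).symm) := by
  have hp : rObj x = p := Subtype.ext hx
  exact (bullet_eq_bridge le_rfl le_rfl h (by rw [hp, dObj_obj, ← h.1])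
    (by rw [hp, dObj_obj, ← h.2]) hx (d_obj q)).trans (comp_of_right_eq _ rfl)

theorem r_bullet_obj_of_PF {x : C} {p q : Obj C} (h : PF p q) (hx : r x = p.1) :
    r (bullet x q.1) = q.1 := by
  rw [r_bullet_obj, show rObj x = p from Subtype.ext hx, ← h.2]

theorem d_eval_cons {q : Obj C} {l : List (Obj C)} (hl : (q :: l).IsChain PF) :
    d (ε.toFun ⟨q :: l, List.cons_ne_nil q l, hl⟩) = q.1 :=
  ε.E2_d ⟨q :: l, List.cons_ne_nil q l, hl⟩

theorem foldl_bullet_eq_comp {l : List (Obj C)} {q : Obj C} {x : C} (hx : r x = q.1)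
    (hl : (q :: l).IsChain PF) :
    l.foldl (fun x q => bullet x q.1) x =
      comp x (ε.toFun ⟨q :: l, List.cons_ne_nil q l, hl⟩) (hx.trans (d_eval_cons hl).symm) := by
  induction l generalizing q x with
  | nil => exact (comp_of_right_eq (hx.trans (d_eval_cons hl).symm) (ε.E1_single q)).symm
  | cons s l ih =>
    obtain ⟨hqs, hl⟩ := List.isChain_cons_cons.1 hl
    have hr := EvaluationMap.r_two ε q s hqs
    have hd := d_eval_cons hl
    have hε := ε.E3 (.pair q s hqs) ⟨s :: l, List.cons_ne_nil s l, hl⟩ rfl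
    rw [List.foldl_cons, ih (r_bullet_obj_of_PF hqs hx) hl]
    exact (comp_congr _ ((r_comp _ _ _).trans (hr.trans hd.symm)) (bullet_obj_of_PF hqs hx)
      rfl).trans ((assoc _ _ _ _ (hr.trans hd.symm)).trans (comp_congr _ _ rfl hε.symm))

theorem foldl_bullet_eq_eval (p : PPath (Obj C)) :
    p.verts.tail.foldl (fun x q => bullet x q.1) p.dom.1 = ε.toFun p := by
  obtain ⟨_ | ⟨q, l⟩, hne, hl⟩ := p
  · exact absurd rfl hne
  · exact (foldl_bullet_eq_comp (r_obj q) hl).trans (comp_of_left_eq _ rfl)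

theorem d_le_d_of_d_bullet_d_bullet_d_eq {x y : C} (h : bullet (bullet (d y) (d x)) (d y) = d x) :
    d x ≤ d y := by
  have hd : d (bullet (d y) (bullet (d x) (d y))) = d x := by
    rw [← bullet_assoc, h]
    exact d_obj (dObj x)
  exact (hd.symm.trans (d_obj_bullet (dObj y) _)).trans_le (le_of_ple (times_ple _ _))

theorem le_iff_bullet (x y : C) :
    x ≤ y ↔ x = bullet (d x) y ∧ bullet (bullet (d y) (d x)) (d y) = d x := by
  refine ⟨fun h => ?_, fun ⟨hx, h⟩ => ?_⟩
  · have hd : (dObj x).1 ≤ (dObj y).1 := OrderedCat.O1_d _ _ h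
    exact ⟨(eq_lres hd h rfl).trans (obj_bullet_of_le hd).symm,
      obj_bullet_obj_bullet_obj_of_le hd⟩
  · have hd : (dObj x).1 ≤ d y := d_le_d_of_d_bullet_d_bullet_d_eq h
    exact (hx.trans (obj_bullet_of_le hd)).trans_le (lres_le _ _ _)

theorem d_obj_bullet_obj (e f : Obj C) : d (bullet e.1 f.1) = (e ×ₚ f).1 := by
  rw [d_obj_bullet, dObj_obj]

theorem r_obj_bullet_obj (e f : Obj C) : r (bullet e.1 f.1) = (e ⋆ₚ f).1 := by
  rw [r_bullet_obj, rObj_obj]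

theorem semigroupChainCat_chainSemigroup {C : Type u} (s : ChainProjectionOrderedCat C) :
    @semigroupChainCat C (chainSemigroup C) = s := by
  refine ChainProjectionOrderedCat.ext_of_eq _ _ (fun _ => rfl) (fun _ => rfl)
    (fun _ _ _ => bullet_eq_comp) (fun x y => (le_iff_bullet x y).symm) ?_ ?_ ?_
  · rintro e f ⟨_, he⟩ ⟨_, hf⟩ rfl rfl
    exact d_obj_bullet_obj (C := C) ⟨e.1, he⟩ ⟨f.1, hf⟩
  · rintro e f ⟨_, he⟩ ⟨_, hf⟩ rfl rfl
    exact r_obj_bullet_obj (C := C) ⟨e.1, he⟩ ⟨f.1, hf⟩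
  · rintro ⟨l, _, _⟩ q h
    obtain rfl : l = q.verts := List.map_injective_iff.2 Subtype.val_injective h
    exact foldl_bullet_eq_eval q

namespace ChainFunctor

theorem map_bridge (φ : ChainFunctor C D) (u v : C) (p q : Obj C) (h hu hv) (h' hu' hv') :
    φ.toFun (bridge u v p q h hu hv) = bridge (φ.toFun u) (φ.toFun v)
      (objMap φ.toFun φ.F1_d p) (objMap φ.toFun φ.F1_d q) h' hu' hv' :=
  (φ.F2 _ _ _).trans (comp_congr _ _ ((φ.F2 _ _ _).trans (comp_congr _ _ rfl (φ.F5 _))) rfl)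

theorem map_bullet (φ : ChainFunctor C D) (a b : C) :
    φ.toFun (bullet a b) = bullet (φ.toFun a) (φ.toFun b) := by
  have hr : objMap φ.toFun φ.F1_d (rObj a) = rObj (φ.toFun a) := Subtype.ext (φ.F1_r a).symm
  have hd : objMap φ.toFun φ.F1_d (dObj b) = dObj (φ.toFun b) := Subtype.ext (φ.F1_d b).symm
  have htimes := φ.F4_times (rObj a) (dObj b)
  have hstar := φ.F4_star (rObj a) (dObj b)
  rw [hr, hd] at htimes hstar
  exact (φ.map_bridge _ _ _ _ (PF_times_star _ _) (r_rres _ _ _) (d_lres _ _ _)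
    (by rw [htimes, hstar]; exact PF_times_star _ _)
    ((φ.F1_r _).trans (congrArg φ.toFun (r_rres _ _ _)))
    ((φ.F1_d _).trans (congrArg φ.toFun (d_lres _ _ _)))).trans
    (bullet_eq_bridge (φ.F3 _ _ (rres_le _ _ _)) (φ.F3 _ _ (lres_le _ _ _)) _ htimes hstar
      _ _).symm

attribute [local instance] chainSemigroup in
/-- A chain projection ordered functor is a (2,1,1)-homomorphism. -/
noncomputable def toBiunaryHom (φ : ChainFunctor C D) : BiunaryHom C D where
  toFun := φ.toFun
  map_mul := φ.map_bullet
  map_plus x := (φ.F1_d x).symm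
  map_ast x := (φ.F1_r x).symm

end ChainFunctor

end

/-! ### Inverses, symmetric and commuting projections -/

section Inverses

variable {S : Type u} [DRCRestrictionSemigroup S]

open DRCRestrictionSemigroup

/-- `a` and `b` are mutually inverse arrows of the category of the restricted product. -/
structure IsInverse (a b : S) : Prop where
  ast_eq : a∗ˢ = b⁺ˢ
  plus_eq : a⁺ˢ = b∗ˢ
  mul_eq_plus : a * b = a⁺ˢ
  mul_eq_ast : b * a = a∗ˢ

namespace IsInverse

variable {x y a b c : S}

theorem symm (h : IsInverse x a) : IsInverse a x :=
  ⟨h.plus_eq.symm, h.ast_eq.symm, h.mul_eq_ast.trans h.ast_eq, h.mul_eq_plus.trans h.plus_eq⟩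

theorem op (h : IsInverse x a) : IsInverse (op x) (op a) :=
  ⟨congrArg MulOpposite.op h.plus_eq, congrArg MulOpposite.op h.ast_eq,
    congrArg MulOpposite.op h.mul_eq_ast, congrArg MulOpposite.op h.mul_eq_plus⟩

theorem mul_plus (h : IsInverse x a) : a * x⁺ˢ = a := by
  rw [h.plus_eq, mul_ast_self]

theorem ast_mul (h : IsInverse x a) : x∗ˢ * a = a := congrArg unop h.op.mul_plus

theorem mul_mul_self (h : IsInverse x a) : x * a * x = x := by
  rw [h.mul_eq_plus, plus_mul_self]

theorem eq_of_mul_eq_ast (h : IsInverse x a) (hb : b * x = x∗ˢ) (hb' : b∗ˢ = x⁺ˢ) : b = a :=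
  calc b = b * x⁺ˢ := by rw [← hb', mul_ast_self]
    _ = b * x * a := by rw [mul_assoc, h.mul_eq_plus]
    _ = a := by rw [hb, h.ast_mul]

theorem unique (ha : IsInverse x a) (hb : IsInverse x b) : b = a :=
  ha.eq_of_mul_eq_ast hb.mul_eq_ast hb.plus_eq.symm

theorem mul_plus_of_mul (h : IsInverse (x * y) c) : c * x⁺ˢ = c :=
  calc c * x⁺ˢ = c * ((x * y)⁺ˢ * x⁺ˢ) := by rw [← mul_assoc, h.mul_plus]
    _ = c := by rw [plus_mul_mul_plus, h.mul_plus]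

theorem ast_mul_of_mul (h : IsInverse (x * y) c) : y∗ˢ * c = c :=
  congrArg unop (h.op.mul_plus_of_mul (x := MulOpposite.op y) (y := MulOpposite.op x))

theorem ast_mul_inverse (h : IsInverse (x * y) c) (h' : IsInverse (x∗ˢ * y) a) : c * x = a := by
  refine h'.eq_of_mul_eq_ast ?_ ?_
  · rw [mul_assoc, ← mul_assoc x, mul_ast_self, h.mul_eq_ast, DRCRestrictionSemigroup.ast_mul]
  · calc (c * x)∗ˢ = ((x * y)⁺ˢ * x)∗ˢ := by rw [DRCRestrictionSemigroup.ast_mul, ← h.plus_eq]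
      _ = (x∗ˢ * (x∗ˢ * y)⁺ˢ)∗ˢ := by rw [ample_plus, DRCRestrictionSemigroup.ast_mul]
      _ = (x∗ˢ * y)⁺ˢ := by rw [(isProj_ast x).mul_plus_mul, plus_ast]

end IsInverse

variable (S) in
/-- Every element has an inverse in the category of the restricted product. -/
def HasInverses : Prop := ∀ a : S, ∃ b : S, IsInverse a b

variable (S) in
/-- The projection algebra of `S` is symmetric in the sense that `e × f = e f e`; the dual identity
`e ⋆ f = f e f` follows. -/
def HasSymmetricProjections : Prop :=
  ∀ ⦃e f : S⦄, IsProj e → IsProj f → (e * f)⁺ˢ = e * f * e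

variable (S) in
/-- Any two projections of `S` commute. -/
def HasCommutingProjections : Prop := ∀ ⦃e f : S⦄, IsProj e → IsProj f → e * f = f * e

namespace HasSymmetricProjections

variable {e f : S}

theorem ast_eq (hs : HasSymmetricProjections S) (he : IsProj e) (hf : IsProj f) :
    (e * f)∗ˢ = f * e * f := by
  have hef : e * f * (e * f) = e * f := by
    rw [← mul_assoc, ← hs he hf, he.plus_mul_cancel]
  have hfef : IsProj (f * e * f) := hs hf he ▸ isProj_plus (f * e)
  calc (e * f)∗ˢ = (e * f * (f * e * f))∗ˢ := by
        rw [mul_assoc f, ← mul_assoc (e * f), mul_assoc e f f, hf.idem, hef]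
    _ = f * e * f * (e * f * (f * e * f))∗ˢ := (hfef.mul_ast_mul _).symm
    _ = f * (e * f * (e * f)∗ˢ) := by
        rw [mul_assoc f e f, ← mul_assoc (e * f) f, mul_assoc e f f, hf.idem, hef, mul_assoc]
    _ = f * e * f := by rw [mul_ast_self, mul_assoc]

theorem op (hs : HasSymmetricProjections S) : HasSymmetricProjections Sᵐᵒᵖ := fun e f he hf =>
  (congrArg MulOpposite.op
    (hs.ast_eq (congrArg unop hf.ast_eq) (congrArg unop he.ast_eq))).trans (mul_assoc e f e).symm

theorem ample_plus (hs : HasSymmetricProjections S) (x y : S) :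
    (x * y)⁺ˢ * x = x * y⁺ˢ * x∗ˢ := by
  rw [DRCRestrictionSemigroup.ample_plus, plus_mul, hs (isProj_ast x) (isProj_plus y),
    ← mul_assoc, ← mul_assoc, mul_ast_self]

theorem ample_ast (hs : HasSymmetricProjections S) (x y : S) :
    x * (y * x)∗ˢ = x⁺ˢ * y∗ˢ * x :=
  (congrArg unop (hs.op.ample_plus (MulOpposite.op x) (MulOpposite.op y))).trans
    (mul_assoc _ _ _).symm

/-- The `P`-restriction semigroup with the operations of a DRC-restriction semigroup that has
symmetric projections. -/
@[reducible]
def toPRestriction (hs : HasSymmetricProjections S) : PRestrictionSemigroup S where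
  plus_mul_self := plus_mul_self
  plus_mul := plus_mul
  plus_proj x y := hs (isProj_plus x) (isProj_plus y)
  plus_idem := plus_idem
  plus_ast := plus_ast
  mul_ast_self := mul_ast_self
  ast_mul := ast_mul
  ast_proj x y := hs.ast_eq (isProj_ast x) (isProj_ast y)
  ast_idem := ast_idem
  ast_plus := ast_plus
  ample_plus := hs.ample_plus
  ample_ast := hs.ample_ast

end HasSymmetricProjections

theorem IsProj.mul_of_plus_comm {e f : S} (he : IsProj e) (hf : IsProj f)
    (h : (e * f)⁺ˢ = (f * e)⁺ˢ) : IsProj (e * f) :=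
  calc (e * f)⁺ˢ = (e * f)⁺ˢ * f := by rw [h, hf.plus_mul_mul]
    _ = e * f := he.plus_mul_cancel f

namespace HasCommutingProjections

variable {e f : S}

theorem isProj_mul (hc : HasCommutingProjections S) (he : IsProj e) (hf : IsProj f) :
    IsProj (e * f) :=
  he.mul_of_plus_comm hf (congrArg (·⁺ˢ) (hc he hf))

theorem hasSymmetricProjections (hc : HasCommutingProjections S) :
    HasSymmetricProjections S := fun e f he hf => by
  rw [(hc.isProj_mul he hf).plus_eq, hc he hf, mul_assoc, he.idem]

theorem op (hc : HasCommutingProjections S) : HasCommutingProjections Sᵐᵒᵖ := fun _ _ he hf =>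
  congrArg MulOpposite.op (hc (congrArg unop hf.ast_eq) (congrArg unop he.ast_eq))

theorem ample_plus (hc : HasCommutingProjections S) (x y : S) : (x * y)⁺ˢ * x = x * y⁺ˢ := by
  rw [DRCRestrictionSemigroup.ample_plus, plus_mul,
    (hc.isProj_mul (isProj_ast x) (isProj_plus y)).plus_eq, ← mul_assoc, mul_ast_self]

theorem ample_ast (hc : HasCommutingProjections S) (x y : S) : x * (y * x)∗ˢ = y∗ˢ * x :=
  congrArg unop (hc.op.ample_plus (MulOpposite.op x) (MulOpposite.op y))

/-- The restriction semigroup with the operations of a DRC-restriction semigroup that has commuting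
projections. -/
@[reducible]
def toRestriction (hc : HasCommutingProjections S) : RestrictionSemigroup S where
  plus_mul_self := plus_mul_self
  plus_comm x y := hc (isProj_plus x) (isProj_plus y)
  plus_proj x y := by
    rw [hc (isProj_plus y) (isProj_plus x),
      (hc.isProj_mul (isProj_plus x) (isProj_plus y)).plus_eq]
  plus_mul_le := plus_mul_plus_mul
  plus_mul := plus_mul
  plus_ast := plus_ast
  mul_ast_self := mul_ast_self
  ast_comm x y := hc (isProj_ast x) (isProj_ast y)
  ast_proj x y := by
    rw [hc (isProj_ast y) (isProj_ast x), (hc.isProj_mul (isProj_ast x) (isProj_ast y)).ast_eq]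
  ast_mul_le x y := congrArg unop (plus_mul_plus_mul (MulOpposite.op y) (MulOpposite.op x))
  ast_mul := ast_mul
  ast_plus := ast_plus
  ample_plus := hc.ample_plus
  ample_ast := hc.ample_ast

end HasCommutingProjections

namespace HasInverses

variable (h : HasInverses S)

/-- The inverse of an element with respect to the restricted product. -/
noncomputable def inv (x : S) : S := (h x).choose

theorem isInverse_inv (x : S) : IsInverse x (h.inv x) := (h x).choose_spec

/-- The generalized regular ∘-semigroup in which `x°` is the inverse of `x` with respect to the
restricted product. -/
@[reducible]
noncomputable def toGenRegular : GenRegularCircSemigroup S where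
  circ := h.inv
  mul_circ_mul x := (h.isInverse_inv x).mul_mul_self
  circ_circ x := (h.isInverse_inv x).symm.unique (h.isInverse_inv _)
  circ_mul_right x y := by
    rw [mul_assoc, (h.isInverse_inv x).mul_eq_plus, (h.isInverse_inv (x * y)).mul_plus_of_mul]
  circ_mul_left x y := by
    rw [(h.isInverse_inv y).mul_eq_ast, (h.isInverse_inv (x * y)).ast_mul_of_mul]
  circ_mul_self x y := by
    rw [(h.isInverse_inv x).mul_eq_ast]
    exact (h.isInverse_inv (x * y)).ast_mul_inverse (h.isInverse_inv (x∗ˢ * y))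

end HasInverses

section Symmetric

variable {x y a b e : S}

theorem IsInverse.mul_rev_mul_eq_ast (hs : HasSymmetricProjections S) (hx : IsInverse x a)
    (hy : IsInverse y b) : b * a * (x * y) = (x * y)∗ˢ :=
  calc b * a * (x * y) = b * (a * x) * y := by simp only [mul_assoc]
    _ = b * (y⁺ˢ * x∗ˢ * y) := by
        rw [hx.mul_eq_ast, ← mul_assoc, ← mul_assoc, hy.mul_plus]
    _ = b * (y * (x * y)∗ˢ) := by rw [hs.ample_ast]
    _ = (x * y)∗ˢ := by rw [← mul_assoc, hy.mul_eq_ast, ast_mul_ast_mul]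

theorem IsInverse.mul_mul_rev_eq_plus (hs : HasSymmetricProjections S) (hx : IsInverse x a)
    (hy : IsInverse y b) : x * y * (b * a) = (x * y)⁺ˢ :=
  congrArg unop (hy.op.mul_rev_mul_eq_ast hs.op hx.op)

theorem IsInverse.mul_rev (hs : HasSymmetricProjections S) (hx : IsInverse x a)
    (hy : IsInverse y b) : IsInverse (x * y) (b * a) where
  ast_eq := (hx.mul_rev_mul_eq_ast hs hy).symm.trans (hy.symm.mul_mul_rev_eq_plus hs hx.symm)
  plus_eq := (hx.mul_mul_rev_eq_plus hs hy).symm.trans (hy.symm.mul_rev_mul_eq_ast hs hx.symm)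
  mul_eq_plus := hx.mul_mul_rev_eq_plus hs hy
  mul_eq_ast := hx.mul_rev_mul_eq_ast hs hy

theorem IsInverse.plus_mul_ast_of_idem (hs : HasSymmetricProjections S) (h : IsInverse e a)
    (he : e * e = e) : e⁺ˢ * e∗ˢ = e := by
  have ha : a * a = a := h.unique (he ▸ h.mul_rev hs h)
  calc e⁺ˢ * e∗ˢ = e * (a * a) * e := by
        rw [← h.mul_eq_plus, ← h.mul_eq_ast]; simp only [mul_assoc]
    _ = e := by rw [ha, h.mul_mul_self]

/-- The regular ∘-semigroup in which `x°` is the inverse of `x` with respect to the restricted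
product. -/
@[reducible]
noncomputable def HasInverses.toRegularCirc (hs : HasSymmetricProjections S) (h : HasInverses S) :
    RegularCircSemigroup S where
  toUnarySemigroup := h.toGenRegular.toUnarySemigroup
  mul_circ_mul := h.toGenRegular.mul_circ_mul
  circ_circ := h.toGenRegular.circ_circ
  circ_mul x y :=
    ((h.isInverse_inv x).mul_rev hs (h.isInverse_inv y)).unique (h.isInverse_inv (x * y))

end Symmetric

theorem HasInverses.isProj_of_idem (h : HasInverses S) (hc : HasCommutingProjections S) {e : S}
    (he : e * e = e) : IsProj e :=
  (h.isInverse_inv e).plus_mul_ast_of_idem hc.hasSymmetricProjections he ▸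
    hc.isProj_mul (isProj_plus e) (isProj_ast e)

/-- The inverse semigroup underlying a DRC-restriction semigroup that has inverses and commuting
projections. -/
@[reducible]
def HasInverses.toInverse (h : HasInverses S) (hc : HasCommutingProjections S) :
    InverseSemigroup S where
  regular x := (h x).imp fun _ ha => ⟨ha.mul_mul_self, ha.symm.mul_mul_self⟩
  idem_comm _ _ he hf := hc (h.isProj_of_idem hc he) (h.isProj_of_idem hc hf)

section

attribute [local instance] semigroupChainCat

theorem isArrowGroupoid_iff : IsArrowGroupoid S ↔ HasInverses S :=
  forall_congr' fun _ => exists_congr fun _ =>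
    ⟨fun ⟨hr, hd, h, h'⟩ => ⟨hr, hd.symm, h, h'⟩, fun h => ⟨h.1, h.2.symm, h.3, h.4⟩⟩

theorem isCommutativeChain_iff : IsCommutativeChain S ↔ HasCommutingProjections S := by
  refine ⟨fun h e f he hf => ?_, fun h e f =>
    Subtype.ext (congrArg (·⁺ˢ) (h (isProj_obj e) (isProj_obj f)))⟩
  have hcomm : (e * f)⁺ˢ = (f * e)⁺ˢ := congrArg Subtype.val (h ⟨e, e, he⟩ ⟨f, f, hf⟩)
  rw [← (he.mul_of_plus_comm hf hcomm).plus_eq, hcomm,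
    (hf.mul_of_plus_comm he hcomm.symm).plus_eq]

theorem isSymmetricChain_iff : IsSymmetricChain S ↔ HasSymmetricProjections S := by
  constructor
  · rintro ⟨hs, hε⟩ e f he hf
    have htimes : (e * f)⁺ˢ = (f * e)∗ˢ := congrArg Subtype.val (hs ⟨e, e, he⟩ ⟨f, f, hf⟩)
    have hstar : (f * e)⁺ˢ = (e * f)∗ˢ := congrArg Subtype.val (hs ⟨f, f, hf⟩ ⟨e, e, he⟩)
    have htriple : (e * f)⁺ˢ * (e * f)∗ˢ * (e * f)⁺ˢ = (e * f)⁺ˢ :=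
      hε _ _ (PF_times_star (⟨e, e, he⟩ : Obj S) ⟨f, f, hf⟩)
    have hrev : (e * f)∗ˢ * (e * f)⁺ˢ = f * e := by
      rw [htimes, ← hstar, hf.plus_mul_ast he]
    calc (e * f)⁺ˢ = (e * f)⁺ˢ * (e * f)∗ˢ * ((e * f)∗ˢ * (e * f)⁺ˢ) := by
          rw [← mul_assoc, mul_assoc _ (e * f)∗ˢ (e * f)∗ˢ, ast_idem, htriple]
      _ = e * f * (f * e) := by rw [hrev, he.plus_mul_ast hf]
      _ = e * f * e := by rw [← mul_assoc, mul_assoc e, hf.idem]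
  · intro h
    have htimes (e f : Obj S) : (e ×ₚ f).1 = e.1 * f.1 * e.1 := h (isProj_obj e) (isProj_obj f)
    have hstar (e f : Obj S) : (e ⋆ₚ f).1 = f.1 * e.1 * f.1 :=
      h.ast_eq (isProj_obj e) (isProj_obj f)
    exact ⟨fun e f => Subtype.ext ((htimes e f).trans (hstar f e).symm), fun p q hPF =>
      (htimes p q).symm.trans (congrArg Subtype.val hPF.1.symm)⟩

end

end Inverses

/-! ### The five classes as conditions on DRC-restriction semigroups -/

section Classes

variable {S : Type u}

theorem PRestrictionSemigroup.hasSymmetricProjections (h : PRestrictionSemigroup S) :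
    @HasSymmetricProjections S h.toDRC := fun e f (he : e⁺ˢ = e) (hf : f⁺ˢ = f) => by
  have hef := h.plus_proj e f
  rwa [he, hf] at hef

theorem RestrictionSemigroup.hasCommutingProjections (h : RestrictionSemigroup S) :
    @HasCommutingProjections S h.toDRC := fun e f (he : e⁺ˢ = e) (hf : f⁺ˢ = f) => by
  have hef := h.plus_comm e f
  rwa [he, hf] at hef

theorem GenRegularCircSemigroup.hasInverses (h : GenRegularCircSemigroup S) :
    @HasInverses S h.toDRC := by
  let := h.toDRC
  exact fun a =>
    have hcirc := h.circ_circ a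
    ⟨a°ˢ, (congrArg (a°ˢ * ·) hcirc).symm, (congrArg (· * a°ˢ) hcirc).symm, rfl, rfl⟩

theorem RegularCircSemigroup.hasSymmetricProjections (h : RegularCircSemigroup S) :
    @HasSymmetricProjections S h.toGenRegular.toDRC := by
  let := h.toGenRegular
  let := h.toGenRegular.toDRC
  intro e f (he : e * e°ˢ = e) hf
  have hcirc {g : S} (hg : g * g°ˢ = g) : g°ˢ = g := by
    simpa only [hg] using GenRegularCircSemigroup.circ_plus g
  calc e * f * (e * f)°ˢ = e * f * (f * e) := by rw [h.circ_mul, hcirc he, hcirc hf]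
    _ = e * f * e := by rw [← mul_assoc, mul_assoc e, IsProj.idem hf]

theorem InverseSemigroup.hasCommutingProjections (h : InverseSemigroup S) :
    @HasCommutingProjections S h.toRegularCirc.toGenRegular.toDRC := by
  let := h.toRegularCirc.toGenRegular.toDRC
  exact fun e f he hf => h.idem_comm e f (IsProj.idem he) (IsProj.idem hf)

end Classes

/-! ### The two functors and their restrictions -/

section Functors

universe v₁ v₂ v₃ u₁ u₂ u₃

variable {A : Type u₁} [Category.{v₁} A] {B : Type u₂} [Category.{v₂} B]
  {D : Type u₃} [Category.{v₃} D]

theorem functor_eq_of_comp_eq {H K : A ⥤ B} (U : B ⥤ D) [U.Faithful]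
    (hobj : ∀ X, H.obj X = K.obj X) (h : H ⋙ U = K ⋙ U) : H = K := by
  refine CategoryTheory.Functor.ext hobj fun X Y f => U.map_injective ?_
  have hmap := Functor.congr_hom h f
  simp only [Functor.comp_map] at hmap
  rw [hmap, U.map_comp, U.map_comp, eqToHom_map, eqToHom_map]

theorem exists_comp_eq_of_fullyFaithful (U : B ⥤ D) [U.Full] [U.Faithful] (H : A ⥤ D)
    (h : ∀ X, ∃ Y, U.obj Y = H.obj X) : ∃ K : A ⥤ B, K ⋙ U = H := by
  choose g hg using h
  let K : A ⥤ B :=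
    { obj := g
      map := fun {X Y} φ => U.preimage (eqToHom (hg X) ≫ H.map φ ≫ eqToHom (hg Y).symm)
      map_id := fun X => U.map_injective (by simp)
      map_comp := fun φ ψ => U.map_injective (by simp) }
  exact ⟨K, CategoryTheory.Functor.ext hg fun _ _ _ => U.map_preimage _⟩

end Functors

theorem MutuallyInverse.restrictToIso {A B X : Type (u + 1)} [Category.{u} A] [Category.{u} B]
    {F : A ⥤ B} {G : B ⥤ A} (hFG : MutuallyInverse F G) {f : X → A} (hf : Function.Injective f)
    {Q : ObjectProperty B} (h : ∀ a, Q (F.obj a) ↔ ∃ x, f x = a) :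
    RestrictToIso F G (inducedFunctor f : InducedCategory A f ⥤ A) Q.ι := by
  have hF (x : InducedCategory A f) : Q ((inducedFunctor f ⋙ F).obj x) := (h _).2 ⟨x, rfl⟩
  have hG (y : Q.FullSubcategory) : ∃ x, (inducedFunctor f).obj x = (Q.ι ⋙ G).obj y :=
    (h _).1 ((Functor.congr_obj hFG.2 y.obj).symm ▸ y.property)
  let F' : InducedCategory A f ⥤ Q.FullSubcategory := Q.lift (inducedFunctor f ⋙ F) hF
  have hF' : F' ⋙ Q.ι = inducedFunctor f ⋙ F := rfl
  obtain ⟨G', hG'⟩ := exists_comp_eq_of_fullyFaithful (inducedFunctor f) (Q.ι ⋙ G) hG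
  have hFG' : (F' ⋙ G') ⋙ inducedFunctor f = 𝟭 _ ⋙ inducedFunctor f := by
    rw [Functor.assoc, hG', ← Functor.assoc, hF', Functor.assoc, hFG.1]
    rfl
  have hGF' : (G' ⋙ F') ⋙ Q.ι = 𝟭 _ ⋙ Q.ι := by
    rw [Functor.assoc, hF', ← Functor.assoc, hG', Functor.assoc, hFG.2]
    rfl
  exact ⟨F', G',
    ⟨functor_eq_of_comp_eq (inducedFunctor f) (fun x => hf (Functor.congr_obj hFG' x)) hFG',
      functor_eq_of_comp_eq Q.ι
        (fun y => ObjectProperty.FullSubcategory.ext (Functor.congr_obj hGF' y)) hGF'⟩, hF', hG'⟩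

instance : DRS.underlying.{u}.Faithful where
  map_injective h := BiunaryHom.ext (funext fun x => ConcreteCategory.congr_hom h x)

instance : CPOC.underlying.{u}.Faithful where
  map_injective h := ChainFunctor.ext (funext fun x => ConcreteCategory.congr_hom h x)

/-- The functor `𝐂` from DRC-restriction semigroups to chain projection ordered categories. -/
noncomputable def toCPOC : DRS.{u} ⥤ CPOC.{u} where
  obj X := ⟨X.carrier, X.nonempty, semigroupChainCat X.carrier⟩
  map φ := φ.toChainFunctor

/-- The functor `𝐒` from chain projection ordered categories to DRC-restriction semigroups. -/
noncomputable def toDRS : CPOC.{u} ⥤ DRS.{u} where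
  obj Y := ⟨Y.carrier, Y.nonempty, chainSemigroup Y.carrier⟩
  map φ := φ.toBiunaryHom

theorem toCPOC_toDRS : MutuallyInverse toCPOC.{u} toDRS.{u} :=
  ⟨functor_eq_of_comp_eq DRS.underlying
      (fun X => congrArg (DRS.mk _ X.nonempty) (chainSemigroup_semigroupChainCat X.str)) rfl,
    functor_eq_of_comp_eq CPOC.underlying
      (fun Y => congrArg (CPOC.mk _ Y.nonempty) (semigroupChainCat_chainSemigroup Y.str)) rfl⟩

theorem isChainCatOf_toCPOC (X : DRS.{u}) : IsChainCatOf X (toCPOC.obj X) :=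
  ⟨semigroupChainCat X.carrier, rfl, fun _ => rfl, fun _ => rfl, fun _ _ _ => rfl,
    fun _ _ => Iff.rfl, fun _ _ => rfl, fun _ _ => rfl, fun _ => rfl⟩

theorem isSemigroupOf_toDRS (Y : CPOC.{u}) : IsSemigroupOf Y (toDRS.obj Y) :=
  ⟨chainSemigroup Y.carrier, rfl, fun _ _ => rfl, fun _ => rfl, fun _ => rfl⟩

/-! ### The classes as full subcategories -/

section Injective

variable {S : Type u}

theorem PRestrictionSemigroup.toDRC_injective :
    Function.Injective (PRestrictionSemigroup.toDRC (S := S)) := by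
  rintro ⟨⟩ ⟨⟩ h
  cases congrArg (fun z : DRCRestrictionSemigroup S => z.toBiunarySemigroup) h
  rfl

theorem RestrictionSemigroup.toDRC_injective :
    Function.Injective (RestrictionSemigroup.toDRC (S := S)) := by
  rintro ⟨⟩ ⟨⟩ h
  cases congrArg (fun z : DRCRestrictionSemigroup S => z.toBiunarySemigroup) h
  rfl

theorem GenRegularCircSemigroup.circ_eq [GenRegularCircSemigroup S] {x a : S}
    (hmul : x * a = x * x°ˢ) (hmul' : a * x = x°ˢ * x) (ha : a * x * a = a) : a = x°ˢ := by
  rw [← ha, mul_assoc, hmul, ← mul_assoc, hmul', circ_mul_circ]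

theorem GenRegularCircSemigroup.toDRC_injective :
    Function.Injective (GenRegularCircSemigroup.toDRC (S := S)) := by
  intro s t h
  have hsemi : s.toSemigroup = t.toSemigroup :=
    congrArg (fun z : DRCRestrictionSemigroup S => z.toSemigroup) h
  have hplus (x : S) := congrArg (fun z : DRCRestrictionSemigroup S => z.plus x) h
  have hast (x : S) := congrArg (fun z : DRCRestrictionSemigroup S => z.ast x) h
  have hs := @circ_mul_circ S s
  have ht := @GenRegularCircSemigroup.circ_eq S t
  rcases s with @⟨@⟨ms, cs⟩⟩
  rcases t with @⟨@⟨mt, ct⟩⟩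
  obtain rfl : ms = mt := hsemi
  obtain rfl : cs = ct := funext fun x => ht (hplus x) (hast x) (hs x)
  rfl

theorem RegularCircSemigroup.toGenRegular_injective :
    Function.Injective (RegularCircSemigroup.toGenRegular (S := S)) := by
  rintro ⟨⟩ ⟨⟩ h
  cases congrArg (fun z : GenRegularCircSemigroup S => z.toUnarySemigroup) h
  rfl

theorem InverseSemigroup.toRegularCirc_injective :
    Function.Injective (InverseSemigroup.toRegularCirc (S := S)) := by
  rintro ⟨⟩ ⟨⟩ h
  cases congrArg (fun z : RegularCircSemigroup S => z.toSemigroup) h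
  rfl

end Injective

theorem GenRegularCirc.toDRS_injective : Function.Injective GenRegularCirc.toDRS.{u} := by
  rintro ⟨_, _, _⟩ ⟨_, _, _⟩ h
  obtain ⟨rfl, h⟩ := DRS.mk.inj h
  obtain rfl := GenRegularCircSemigroup.toDRC_injective (eq_of_heq h)
  rfl

theorem PRestriction.toDRS_injective : Function.Injective PRestriction.toDRS.{u} := by
  rintro ⟨_, _, _⟩ ⟨_, _, _⟩ h
  obtain ⟨rfl, h⟩ := DRS.mk.inj h
  obtain rfl := PRestrictionSemigroup.toDRC_injective (eq_of_heq h)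
  rfl

theorem RegularCirc.toDRS_injective : Function.Injective RegularCirc.toDRS.{u} := by
  rintro ⟨_, _, _⟩ ⟨_, _, _⟩ h
  obtain ⟨rfl, h⟩ := DRS.mk.inj h
  obtain rfl := RegularCircSemigroup.toGenRegular_injective
    (GenRegularCircSemigroup.toDRC_injective (eq_of_heq h))
  rfl

theorem Restriction.toDRS_injective : Function.Injective Restriction.toDRS.{u} := by
  rintro ⟨_, _, _⟩ ⟨_, _, _⟩ h
  obtain ⟨rfl, h⟩ := DRS.mk.inj h
  obtain rfl := RestrictionSemigroup.toDRC_injective (eq_of_heq h)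
  rfl

theorem Inverse.toDRS_injective : Function.Injective Inverse.toDRS.{u} := by
  rintro ⟨_, _, _⟩ ⟨_, _, _⟩ h
  obtain ⟨rfl, h⟩ := DRS.mk.inj h
  obtain rfl := InverseSemigroup.toRegularCirc_injective
    (RegularCircSemigroup.toGenRegular_injective
      (GenRegularCircSemigroup.toDRC_injective (eq_of_heq h)))
  rfl

theorem DRS.ext_of_eq (X : DRS.{u}) (s : DRCRestrictionSemigroup X.carrier)
    (hm : ∀ x y, s.mul x y = X.str.mul x y) (hp : ∀ x, s.plus x = X.str.plus x)
    (ha : ∀ x, s.ast x = X.str.ast x) : (⟨X.carrier, X.nonempty, s⟩ : DRS) = X :=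
  congrArg (DRS.mk X.carrier X.nonempty) (DRCRestrictionSemigroup.ext_of_eq s X.str hm hp ha)

theorem isGroupoid_toCPOC_iff (X : DRS.{u}) :
    CPOC.isGroupoid (toCPOC.obj X) ↔ ∃ S : GenRegularCirc, S.toDRS = X := by
  refine (isArrowGroupoid_iff (S := X.carrier)).trans ⟨fun h => ?_, ?_⟩
  · exact ⟨⟨X.carrier, X.nonempty, h.toGenRegular⟩, X.ext_of_eq _ (fun _ _ => rfl)
      (fun x => (h.isInverse_inv x).mul_eq_plus) (fun x => (h.isInverse_inv x).mul_eq_ast)⟩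
  · rintro ⟨S, rfl⟩
    exact S.str.hasInverses

theorem isSymmetric_toCPOC_iff (X : DRS.{u}) :
    CPOC.isSymmetric (toCPOC.obj X) ↔ ∃ S : PRestriction, S.toDRS = X := by
  refine (isSymmetricChain_iff (S := X.carrier)).trans ⟨fun h => ?_, ?_⟩
  · exact ⟨⟨X.carrier, X.nonempty, h.toPRestriction⟩, rfl⟩
  · rintro ⟨S, rfl⟩
    exact S.str.hasSymmetricProjections

theorem isSymmetricGroupoid_toCPOC_iff (X : DRS.{u}) :
    CPOC.isSymmetricGroupoid (toCPOC.obj X) ↔ ∃ S : RegularCirc, S.toDRS = X := by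
  refine (and_congr (isSymmetricChain_iff (S := X.carrier))
    (isArrowGroupoid_iff (S := X.carrier))).trans ⟨fun ⟨hs, h⟩ => ?_, ?_⟩
  · exact ⟨⟨X.carrier, X.nonempty, h.toRegularCirc hs⟩, X.ext_of_eq _ (fun _ _ => rfl)
      (fun x => (h.isInverse_inv x).mul_eq_plus) (fun x => (h.isInverse_inv x).mul_eq_ast)⟩
  · rintro ⟨S, rfl⟩
    exact ⟨S.str.hasSymmetricProjections, S.str.toGenRegular.hasInverses⟩

theorem isCommutative_toCPOC_iff (X : DRS.{u}) :
    CPOC.isCommutative (toCPOC.obj X) ↔ ∃ S : Restriction, S.toDRS = X := by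
  refine (isCommutativeChain_iff (S := X.carrier)).trans ⟨fun h => ?_, ?_⟩
  · exact ⟨⟨X.carrier, X.nonempty, h.toRestriction⟩, rfl⟩
  · rintro ⟨S, rfl⟩
    exact S.str.hasCommutingProjections

theorem isCommutativeGroupoid_toCPOC_iff (X : DRS.{u}) :
    CPOC.isCommutativeGroupoid (toCPOC.obj X) ↔ ∃ S : Inverse, S.toDRS = X := by
  refine (and_congr (isCommutativeChain_iff (S := X.carrier))
    (isArrowGroupoid_iff (S := X.carrier))).trans ⟨fun ⟨hc, h⟩ => ?_, ?_⟩
  · let := h.toInverse hc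
    have hinv (x : X.carrier) : invElt x = h.inv x :=
      (eq_invElt (h.isInverse_inv x).mul_mul_self (h.isInverse_inv x).symm.mul_mul_self).symm
    exact ⟨⟨X.carrier, X.nonempty, h.toInverse hc⟩, X.ext_of_eq _ (fun _ _ => rfl)
      (fun x => (congrArg (x * ·) (hinv x)).trans (h.isInverse_inv x).mul_eq_plus)
      (fun x => (congrArg (· * x) (hinv x)).trans (h.isInverse_inv x).mul_eq_ast)⟩
  · rintro ⟨S, rfl⟩
    exact ⟨S.str.hasCommutingProjections, S.str.toRegularCirc.toGenRegular.hasInverses⟩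

end ChainPO

theorem theorem6p9 :
    ∃ (C : ChainPO.DRS.{u} ⥤ ChainPO.CPOC.{u}) (S : ChainPO.CPOC.{u} ⥤ ChainPO.DRS.{u}),
      ChainPO.MutuallyInverse C S ∧
      C ⋙ ChainPO.CPOC.underlying = ChainPO.DRS.underlying ∧
      S ⋙ ChainPO.DRS.underlying = ChainPO.CPOC.underlying ∧
      (∀ X, ChainPO.IsChainCatOf X (C.obj X)) ∧
      (∀ Y, ChainPO.IsSemigroupOf Y (S.obj Y)) ∧
      ChainPO.RestrictToIso C S
        (inducedFunctor ChainPO.GenRegularCirc.toDRS : ChainPO.GenRegularCircCat.{u} ⥤ ChainPO.DRS.{u})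
        ChainPO.CPOC.isGroupoid.ι ∧
      ChainPO.RestrictToIso C S
        (inducedFunctor ChainPO.PRestriction.toDRS : ChainPO.PRestrictionCat.{u} ⥤ ChainPO.DRS.{u})
        ChainPO.CPOC.isSymmetric.ι ∧
      ChainPO.RestrictToIso C S
        (inducedFunctor ChainPO.RegularCirc.toDRS : ChainPO.RegularCircCat.{u} ⥤ ChainPO.DRS.{u})
        ChainPO.CPOC.isSymmetricGroupoid.ι ∧
      ChainPO.RestrictToIso C S
        (inducedFunctor ChainPO.Restriction.toDRS : ChainPO.RestrictionCat.{u} ⥤ ChainPO.DRS.{u})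
        ChainPO.CPOC.isCommutative.ι ∧
      ChainPO.RestrictToIso C S
        (inducedFunctor ChainPO.Inverse.toDRS : ChainPO.InverseCat.{u} ⥤ ChainPO.DRS.{u})
        ChainPO.CPOC.isCommutativeGroupoid.ι :=
  open ChainPO in
  ⟨toCPOC, toDRS, toCPOC_toDRS, rfl, rfl, isChainCatOf_toCPOC, isSemigroupOf_toDRS,
    toCPOC_toDRS.restrictToIso GenRegularCirc.toDRS_injective isGroupoid_toCPOC_iff,
    toCPOC_toDRS.restrictToIso PRestriction.toDRS_injective isSymmetric_toCPOC_iff,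
    toCPOC_toDRS.restrictToIso RegularCirc.toDRS_injective isSymmetricGroupoid_toCPOC_iff,
    toCPOC_toDRS.restrictToIso Restriction.toDRS_injective isCommutative_toCPOC_iff,
    toCPOC_toDRS.restrictToIso Inverse.toDRS_injective isCommutativeGroupoid_toCPOC_iff⟩
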